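/- **Setting.** Let $\Delta$ be the root system of a simply-laced simple complex Lie algebra $\mathfrak g$ (an irreducible, reduced, crystallographic root system of type $A$, $D$ or $E$) in the real vector space $\mathfrak h^*_{\mathbb R}$, with coroots $\alpha^\vee\in\mathfrak h_{\mathbb R}$ and pairing $\langle\cdot,\cdot\rangle$, positive roots $\Delta^+$, simple roots $\alpha_i$ ($i\in I$), $\Delta^-=-\Delta^+$, $\rho=\frac12\sum_{\alpha\in\Delta^+}\alpha$, weight lattice $P=\{\lambda:\langle\lambda,\alpha_i^\vee\rangle\in\mathbb Z\ \text{for all } i\in I\}$, Weyl group $W$ generated by the reflections $s_{\alpha_i}$, with length $\ell$ and Bruhat order $<$. Put $\operatorname{sgn}(\alpha)=\pm1$ for $\alpha\in\pm\Delta^+$ and $|\alpha|=\operatorname{sgn}(\alpha)\alpha$. The quantum Bruhat graph $\mathrm{QBG}(W)$ has vertex set $W$ and an edge $x\xrightarrow{\alpha}xs_\alpha$ ($\alpha\in\Delta^+$) whenever $\ell(xs_\alpha)=\ell(x)+1$ or $\ell(xs_\alpha)=\ell(x)-2\langle\rho,\alpha^\vee\rangle+1$. For $\alpha\in\Delta$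 and $k\in\mathbb Z$ let $H_{\alpha,k}=\{\nu\in\mathfrak h^*_{\mathbb R}:\langle\nu,\alpha^\vee\rangle=k\}$ and $\hat r_{\alpha,k}(\nu)=\nu-(\langle\nu,\alpha^\vee\rangle-k)\alpha$. Alcoves are the connected components of the complement of all the $H_{\alpha,k}$, and $A_\circ=\{\nu:0<\langle\nu,\alpha^\vee\rangle<1\ \text{for all }\alpha\in\Delta^+\}$. Write $A\xrightarrow{\alpha}B$ if the distinct alcoves $A,B$ have a common wall (a common face of codimension one) which is orthogonal to $\alpha$, and $\alpha$ points from $A$ to $B$. For $\lambda\in P$, $\mathrm{AP}(\lambda)$ is the set of alcove paths $\Gamma: A_\circ=A_0\xrightarrow{\gamma_1}A_1\xrightarrow{\gamma_2}\cdots\xrightarrow{\gamma_m}A_m=A_\circ+\lambda$; write $\Gamma=(\gamma_1,\dots,\gamma_m)$, let $H_{\gamma_t,l_t}$ be the hyperplane between $A_{t-1}$ and $A_t$, and put $l'_t=\langle\lambda,\gamma_t^\vee\rangle-l_t$. For $w\in W$, let $\mathrm{QW}_{\lambda,w}(\Gamma)$ be the set of sequences $\mathbf w=(w_0,\dots,w_m)$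 in $W$ with $w_0=w$ and $w_t\in\{w_{t-1},s_{\gamma_t}w_{t-1}\}$ for all $1\le t\le m$, such that $w_{t-1}\to w_t$ is an edge of $\mathrm{QBG}(W)$ whenever $w_t=s_{\gamma_t}w_{t-1}$. Put $$T(\mathbf w)=\{t: w_t=s_{\gamma_t}w_{t-1}\},\qquad T^-(\mathbf w)=\{t:w_{t-1}>w_t\},$$ $$S(\mathbf w)=\{t: w_t=w_{t-1}\text{ and }-w_t^{-1}\gamma_t\text{ is a simple root}\}.$$ Let $\widetilde{\mathrm{QW}}_{\lambda,w}(\Gamma)$ be the set of pairs $(\mathbf w,\mathbf b)$ with $\mathbf w\in \mathrm{QW}_{\lambda,w}(\Gamma)$ and $\mathbf b:S(\mathbf w)\to\{0,1\}$. For such a pair define $\mathrm{end}(\mathbf w,\mathbf b)=w_m$, $$(-1)^{(\mathbf w,\mathbf b)}=\prod_{\gamma_t\in\Delta^-,\,w_{t-1}>w_t}(-1)\prod_{\gamma_t\in\Delta^+,\,w_{t-1}<w_t}(-1)\prod_{t\in S(\mathbf w)}(-1)^{\mathbf b(t)},$$ $$\mathrm{qwt}_t=\sum_{u\le t,\,u\in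 T^-(\mathbf w)}|w_u^{-1}\gamma_u|-\sum_{u\le t,\,u\in S(\mathbf w)}\mathbf b(u)w_u^{-1}\gamma_u,\qquad \mathrm{qwt}(\mathbf w,\mathbf b)=\mathrm{qwt}_m,$$ and $\mathrm{qwt}^\vee_t$, $\mathrm{qwt}^\vee(\mathbf w,\mathbf b)=\mathrm{qwt}^\vee_m$ by the same formulas with each root replaced by its coroot. Let $\hat r_0=w^{-1}$, $\hat r_t=\hat r_{t-1}\hat r_{\gamma_t,l_t}$ if $t\in T(\mathbf w)$ and $\hat r_t=\hat r_{t-1}$ otherwise; $\mathrm{wt}_t=\hat r_t\lambda-\hat r_{t-1}\lambda$ for $1\le t\le m$, $\mathrm{wt}(\mathbf w,\mathbf b)=\hat r_m\lambda$; and $$\deg(\mathbf w,\mathbf b)=\tfrac12\langle\mathrm{qwt},\mathrm{qwt}^\vee\rangle+\sum_{t=1}^m\langle\mathrm{wt}_t,\mathrm{qwt}^\vee_t\rangle-\sum_{t\in T^-(\mathbf w)}\operatorname{sgn}(\gamma_t)l'_t-\sum_{t\in S(\mathbf w)}\mathbf b(t)l'_t.$$ **Theorem.** Let $\lambda\in P$,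 $w\in W$ and $\Gamma,\Xi\in\mathrm{AP}(\lambda)$, and assume that $\Xi$ is obtained from $\Gamma$ by deleting a segment of the form $\alpha,-\alpha$ with $\alpha\in\Delta$ from the sequence of roots of $\Gamma$. Then there is a subset $\widetilde{\mathrm{QW}}^{(1)}_{\lambda,w}(\Gamma)\subset\widetilde{\mathrm{QW}}_{\lambda,w}(\Gamma)$ such that: 1. there is a bijection $\mathsf D:\widetilde{\mathrm{QW}}^{(1)}_{\lambda,w}(\Gamma)\to\widetilde{\mathrm{QW}}_{\lambda,w}(\Xi)$ that preserves the sign $(-1)^{(\mathbf w,\mathbf b)}$ and the statistics $\mathrm{end}$, $\mathrm{qwt}$, $\mathrm{qwt}^\vee$, $\mathrm{wt}$ and $\deg$; 2. there is an involution of $\widetilde{\mathrm{QW}}_{\lambda,w}(\Gamma)\setminus\widetilde{\mathrm{QW}}^{(1)}_{\lambda,w}(\Gamma)$ that changes the sign $(-1)^{(\mathbf w,\mathbf b)}$ to its negative and preserves $\mathrm{end}$, $\mathrm{qwt}$, $\mathrm{qwt}^\vee$, $\mathrm{wt}$ and $\deg$. -/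

import Mathlib

noncomputable section

open RootPairing

namespace QuantumWalk

/-- The length of an element of the Weyl group: the least number of factors in an expression as a
product of simple reflections. -/
def length {ι M N : Type*} [AddCommGroup M] [Module ℝ M] [AddCommGroup N] [Module ℝ N]
    {P : RootPairing ι ℝ M N} (b : P.Base) (w : P.weylGroup) : ℕ :=
  sInf {n : ℕ | ∃ s : List ι, s.length = n ∧ (∀ i ∈ s, i ∈ b.support) ∧
    (s.map (weylGroup.ofIdx P)).prod = w}

variable {ι M N : Type*} [AddCommGroup M] [Module ℝ M] [AddCommGroup N] [Module ℝ N]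
  {P : RootPairing ι ℝ M N} (b : P.Base)

/-! ### Signs of roots, weights

Roots are referred to through their indices `i : ι`: the root is `P.root i`, its coroot is
`P.coroot i`, and `w • i` is the index of the root `w (P.root i)`. -/

variable (P) in
/-- The index of the root `-α`, where `i` is the index of `α`. -/
def negIdx (i : ι) : ι := P.reflectionPerm i i

open scoped Classical in
/-- `sgn α`: `1` for a positive root and `-1` for a negative root. -/
def sgn (i : ι) : ℤ := if b.IsPos i then 1 else -1

open scoped Classical in
/-- The index of `|α| = sgn(α) α`. -/
def absIdx (i : ι) : ι := if b.IsPos i then i else negIdx P i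

/-- The half sum of the positive roots. -/
def rho : M := (1 / 2 : ℝ) • ∑ᶠ i ∈ {i : ι | b.IsPos i}, P.root i

/-- The weight lattice, i.e. the integral span of the fundamental weights: those vectors whose
pairings with all simple coroots are integers. -/
def weightLattice : Set M :=
  {μ | ∀ i ∈ b.support, ∃ n : ℤ, P.toLinearMap μ (P.coroot i) = n}

/-! ### Bruhat order and the quantum Bruhat graph -/

/-- The strict Bruhat order on the Weyl group: the transitive closure of the relation consisting
of the pairs `x`, `x * s_α` with `ℓ x < ℓ (x * s_α)`. -/
def BruhatLT : P.weylGroup → P.weylGroup → Prop :=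
  Relation.TransGen fun x y => (∃ i : ι, y = x * weylGroup.ofIdx P i) ∧ length b x < length b y

/-- `IsEdge b x i y`: there is an edge `x → y` with label the positive root `α` of index `i` in the
quantum Bruhat graph: `y = x s_α`, and either `ℓ y = ℓ x + 1` (Bruhat edge) or
`ℓ y = ℓ x - 2 ⟨ρ, α^∨⟩ + 1` (quantum edge). -/
def IsEdge (x : P.weylGroup) (i : ι) (y : P.weylGroup) : Prop :=
  b.IsPos i ∧ y = x * weylGroup.ofIdx P i ∧
    (length b y = length b x + 1 ∨
      (length b y : ℝ) = length b x - 2 * P.toLinearMap (rho b) (P.coroot i) + 1)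

/-! ### Alcoves and alcove paths -/

variable (P) in
/-- The affine hyperplane `H_{α,k} = {ν | ⟨ν, α^∨⟩ = k}`. -/
def hyperplane (i : ι) (k : ℤ) : Set M := {ν | P.toLinearMap ν (P.coroot i) = k}

variable (P) in
/-- The affine reflection `ν ↦ ν - (⟨ν, α^∨⟩ - k) α` in the hyperplane `H_{α,k}`. -/
def affineReflection (i : ι) (k : ℤ) (ν : M) : M :=
  ν - (P.toLinearMap ν (P.coroot i) - k) • P.root i

variable (P) in
/-- An alcove: a connected component of the complement of all the hyperplanes `H_{α,k}`. -/
def IsAlcove [TopologicalSpace M] (A : Set M) : Prop :=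
  ∃ ν ∈ (⋃ (i : ι) (k : ℤ), hyperplane P i k)ᶜ,
    A = connectedComponentIn (⋃ (i : ι) (k : ℤ), hyperplane P i k)ᶜ ν

/-- The fundamental alcove `A_∘`. -/
def fundamentalAlcove : Set M :=
  {ν | ∀ i, b.IsPos i → 0 < P.toLinearMap ν (P.coroot i) ∧ P.toLinearMap ν (P.coroot i) < 1}

variable (P) in
/-- `Crosses P A i k B`: the alcoves `A` and `B` have a common wall, this wall lies in `H_{α,k}`
(`α` being the root of index `i`), and `α` points in the direction from `A` to `B`.
A wall of `A` is a set of the form `closure A ∩ H` with `H` a hyperplane, such that this set spans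
`H` affinely (a face of codimension one). -/
structure Crosses [TopologicalSpace M] (A : Set M) (i : ι) (k : ℤ) (B : Set M) : Prop where
  wall : (affineSpan ℝ (closure A ∩ hyperplane P i k) : Set M) = hyperplane P i k
  common : closure A ∩ hyperplane P i k = closure B ∩ hyperplane P i k
  left : ∀ ν ∈ A, P.toLinearMap ν (P.coroot i) < k
  right : ∀ ν ∈ B, k < P.toLinearMap ν (P.coroot i)

/-- An alcove path `A_∘ = A_0 → A_1 → ⋯ → A_m = A_∘ + μ`, where `A_t → A_{t+1}` crosses the
hyperplane `H_{γ_t, l_t}` in the direction of `γ_t` for `0 ≤ t < m`. The roots `γ_t` and the integers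
`l_t` are determined by the alcoves; they are recorded for convenience.
(Steps are numbered from `0`, so that the step `t` here goes from `A_t` to `A_{t+1}`.) -/
structure AlcovePath [TopologicalSpace M] (μ : M) where
  m : ℕ
  alcove : Fin (m + 1) → Set M
  γ : Fin m → ι
  l : Fin m → ℤ
  isAlcove : ∀ t, IsAlcove P (alcove t)
  crosses : ∀ t : Fin m, Crosses P (alcove t.castSucc) (γ t) (l t) (alcove t.succ)
  start : alcove 0 = fundamentalAlcove b
  finish : alcove (Fin.last m) = (fun ν => ν + μ) '' fundamentalAlcove b

/-- `Ξ` is obtained from `Γ` by deleting a segment `α, -α` from the sequence of roots of `Γ`. -/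
def IsDeletion [TopologicalSpace M] {μ : M} (Γ Ξ : AlcovePath b μ) : Prop :=
  ∃ (s₁ s₂ : List ι) (i : ι), List.ofFn Γ.γ = s₁ ++ i :: negIdx P i :: s₂ ∧
    List.ofFn Ξ.γ = s₁ ++ s₂

/-! ### Quantum walks -/

/-- The quantum walks `(w_0, …, w_m)` along the sequence of roots `γ`, beginning at `w`. -/
structure Walk {m : ℕ} (γ : Fin m → ι) (w : P.weylGroup) where
  pt : Fin (m + 1) → P.weylGroup
  start : pt 0 = w
  step : ∀ t : Fin m,
    pt t.succ = pt t.castSucc ∨ pt t.succ = weylGroup.ofIdx P (γ t) * pt t.castSucc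
  edge : ∀ t : Fin m, pt t.succ = weylGroup.ofIdx P (γ t) * pt t.castSucc →
    ∃ i, IsEdge b (pt t.castSucc) i (pt t.succ)

namespace Walk

variable {b} {m : ℕ} {γ : Fin m → ι} {w : P.weylGroup} (W : Walk b γ w)

/-- The end `w_m` of the walk. -/
def ed : P.weylGroup := W.pt (Fin.last m)

/-- The set `T` of non-stationary steps. -/
def T : Set (Fin m) := {t | W.pt t.succ = weylGroup.ofIdx P (γ t) * W.pt t.castSucc}

/-- The set `T⁻` of descending steps. -/
def Tminus : Set (Fin m) := {t | BruhatLT b (W.pt t.succ) (W.pt t.castSucc)}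

/-- The set of ascending steps. -/
def Tplus : Set (Fin m) := {t | BruhatLT b (W.pt t.castSucc) (W.pt t.succ)}

/-- The set `S` of stationary steps such that `-w_t⁻¹ γ_t` is a simple root. -/
def S : Set (Fin m) :=
  {t | W.pt t.succ = W.pt t.castSucc ∧ negIdx P ((W.pt t.succ)⁻¹ • γ t) ∈ b.support}

open scoped Classical in
/-- The maps `r̂_0 = w⁻¹` and `r̂_t = r̂_{t-1} ∘ r̂_{γ_t, l_t}` or `r̂_{t-1}`, according to whether the
`t`-th step is in `T` or not. -/
def rhat (l : Fin m → ℤ) : Fin (m + 1) → M → M :=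
  Fin.induction (motive := fun _ => M → M) (fun ν => w⁻¹ • ν)
    (fun t r => if t ∈ W.T then r ∘ affineReflection P (γ t) (l t) else r)

/-- The increments `wt_t = r̂_t μ - r̂_{t-1} μ` for the steps `t`. -/
def wtStep (l : Fin m → ℤ) (μ : M) (t : Fin m) : M :=
  W.rhat l t.succ μ - W.rhat l t.castSucc μ

/-- The weight `wt = r̂_m μ`. -/
def wt (l : Fin m → ℤ) (μ : M) : M := W.rhat l (Fin.last m) μ

end Walk

/-- The decorated quantum walks: pairs of a quantum walk and a function `S → {0,1}`. -/
structure DecoratedWalk {m : ℕ} (γ : Fin m → ι) (w : P.weylGroup) where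
  walk : Walk b γ w
  dec : walk.S → Fin 2

namespace DecoratedWalk

variable {b} {m : ℕ} {γ : Fin m → ι} {w : P.weylGroup} (D : DecoratedWalk b γ w)

/-- The end of a decorated walk. -/
def ed : P.weylGroup := D.walk.ed

/-- The weight of a decorated walk. -/
def wt (l : Fin m → ℤ) (μ : M) : M := D.walk.wt l μ

open scoped Classical in
/-- The decoration, extended by `0` outside `S`. -/
def val (t : Fin m) : ℕ := if h : t ∈ D.walk.S then (D.dec ⟨t, h⟩ : ℕ) else 0

open scoped Classical in
/-- The sign of a decorated walk. -/
def sign : ℤ :=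
  (∏ t : Fin m with ¬ b.IsPos (γ t) ∧ t ∈ D.walk.Tminus, (-1)) *
  (∏ t : Fin m with b.IsPos (γ t) ∧ t ∈ D.walk.Tplus, (-1)) *
  ∏ t : Fin m with t ∈ D.walk.S, (-1) ^ D.val t

open scoped Classical in
/-- `qwt_t`: the sum over the first `t` steps of `|w_u⁻¹ γ_u|` for `u ∈ T⁻` and
`-b(u) w_u⁻¹ γ_u` for `u ∈ S`. -/
def qwtAt (t : Fin (m + 1)) : M :=
  (∑ u : Fin m with u.castSucc < t ∧ u ∈ D.walk.Tminus,
    P.root (absIdx b ((D.walk.pt u.succ)⁻¹ • γ u))) +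
  ∑ u : Fin m with u.castSucc < t ∧ u ∈ D.walk.S,
    -(D.val u • P.root ((D.walk.pt u.succ)⁻¹ • γ u))

/-- `qwt = qwt_m`. -/
def qwt : M := D.qwtAt (Fin.last m)

open scoped Classical in
/-- `qwt_t^∨`: the analogue of `qwt_t` for coroots. -/
def qwtCoAt (t : Fin (m + 1)) : N :=
  (∑ u : Fin m with u.castSucc < t ∧ u ∈ D.walk.Tminus,
    P.coroot (absIdx b ((D.walk.pt u.succ)⁻¹ • γ u))) +
  ∑ u : Fin m with u.castSucc < t ∧ u ∈ D.walk.S,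
    -(D.val u • P.coroot ((D.walk.pt u.succ)⁻¹ • γ u))

/-- `qwt^∨ = qwt_m^∨`. -/
def qwtCo : N := D.qwtCoAt (Fin.last m)

variable (γ) in
/-- `l'_t = ⟨μ, γ_t^∨⟩ - l_t`. -/
def lPrime (P : RootPairing ι ℝ M N) (l : Fin m → ℤ) (μ : M) (t : Fin m) : ℝ :=
  P.toLinearMap μ (P.coroot (γ t)) - l t

open scoped Classical in
/-- `deg' = ∑_t ⟨wt_t, qwt_t^∨⟩ - ∑_{t ∈ T⁻} sgn(γ_t) l'_t - ∑_{t ∈ S} b(t) l'_t`. -/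
def deg' (l : Fin m → ℤ) (μ : M) : ℝ :=
  (∑ t : Fin m, P.toLinearMap (D.walk.wtStep l μ t) (D.qwtCoAt t.succ)) -
  (∑ t : Fin m with t ∈ D.walk.Tminus, (sgn b (γ t) : ℝ) * lPrime γ P l μ t) -
  ∑ t : Fin m with t ∈ D.walk.S, (D.val t : ℝ) * lPrime γ P l μ t

/-- `deg = ⟨qwt, qwt^∨⟩ / 2 + deg'`. -/
def deg (l : Fin m → ℤ) (μ : M) : ℝ :=
  P.toLinearMap D.qwt D.qwtCo / 2 + D.deg' l μ

end DecoratedWalk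

/-- `QW̃_{μ,w}(Γ)`: the set of decorated quantum walks along the alcove path `Γ` beginning at `w`. -/
abbrev QW [TopologicalSpace M] {μ : M} (Γ : AlcovePath b μ) (w : P.weylGroup) : Type _ :=
  DecoratedWalk b Γ.γ w

variable {b} in
/-- Two decorated walks (along possibly different alcove paths) agree in `ed`, `qwt`, `qwt^∨`, `wt`
and `deg`. -/
structure SameStatistics [TopologicalSpace M] {μ : M} {Γ Ξ : AlcovePath b μ} {w : P.weylGroup}
    (D : QW b Γ w) (E : QW b Ξ w) : Prop where
  ed : E.ed = D.ed
  qwt : E.qwt = D.qwt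
  qwtCo : E.qwtCo = D.qwtCo
  wt : E.wt Ξ.l μ = D.wt Γ.l μ
  deg : E.deg Ξ.l μ = D.deg Γ.l μ

end QuantumWalk

end

/-!
# Deleting a segment `α, -α` from an alcove path

A decorated quantum walk amounts to a choice at each step: to stay with decoration `0`, to stay with
decoration `1` (possible if `-w_t⁻¹ γ_t` is simple), or to move (possible along an edge of the
quantum Bruhat graph). All statistics are accumulated step by step (`State.step`,
`DecoratedWalk.stateAt_succ`), so that only the two steps along `α, -α` have to be analysed. Both
cross the same hyperplane: the position of an alcove relative to all hyperplanes is determined by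
the sequence of roots crossed before (`Crosses.floor`), so the integers `l` of the two steps are
opposite, and the deletion leaves the other integers unchanged (`IsDeletion.exists_levels`).

Let `v` be the position before the two steps and put `j = v⁻¹ α`. The subset of the theorem consists
of the walks which stay with decoration `0` twice; forgetting the two steps is a bijection. On the
other walks the involution (`swap`) exchanges `(c, move)` with `(move, c)`, and `(move, move)` with
`(stay, stayOne)` or `(stayOne, stay)`, depending on which of `j` and `-j` is simple. If neither is,
`(move, move)` does not occur: edges in both directions between `v` and `v s_j` force
`⟨ρ, |j|^∨⟩ = 1`, so `|j|` is simple (`mem_support_of_canMove`). In each case the statistics agree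
after the two steps except for the sign, which changes (`swap_spec`). For the degree this rests on
`⟨j, j^∨⟩ = 2` and on the relation, for simple `|j|`, between the sign of `α` and the direction of
the move in the Bruhat order (`length_ofIdx_mul`, a consequence of the exchange property
`exists_word_exchange`).
-/

noncomputable section

open RootPairing

namespace QuantumWalk

variable {ι M N : Type*} [AddCommGroup M] [Module ℝ M] [AddCommGroup N] [Module ℝ N]
  {P : RootPairing ι ℝ M N}

/-! ### Roots and reflections -/

@[simp] lemma root_negIdx (i : ι) : P.root (negIdx P i) = -P.root i := by simp [negIdx]

@[simp] lemma coroot_negIdx (i : ι) : P.coroot (negIdx P i) = -P.coroot i := by simp [negIdx]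

@[simp] lemma negIdx_negIdx (i : ι) : negIdx P (negIdx P i) = i :=
  P.root.injective <| by simp

lemma negIdx_ne (i : ι) : negIdx P i ≠ i := fun h => P.ne_neg i h.symm

@[simp] lemma isPos_negIdx (b : P.Base) (i : ι) : b.IsPos (negIdx P i) ↔ ¬ b.IsPos i :=
  RootPairing.Base.IsPos.neg_iff_not b i

lemma root_smul (w : P.weylGroup) (i : ι) : P.root (w • i) = w • P.root i :=
  (weylGroup_apply_root P w i).symm

@[simp] lemma smul_negIdx (w : P.weylGroup) (i : ι) : w • negIdx P i = negIdx P (w • i) :=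
  P.root.injective <| by simp [root_smul]

lemma ofIdx_smul_idx (i j : ι) : weylGroup.ofIdx P i • j = P.reflectionPerm i j := rfl

@[simp] lemma ofIdx_smul_self (i : ι) : weylGroup.ofIdx P i • i = negIdx P i := rfl

lemma weylGroup_ext {x y : P.weylGroup} (h : ∀ m : M, x • m = y • m) : x = y := by
  apply Subtype.ext
  apply Equiv.weightHom_injective P
  ext m
  exact h m

@[simp] lemma ofIdx_mul_self (i : ι) : weylGroup.ofIdx P i * weylGroup.ofIdx P i = 1 :=
  weylGroup_ext fun m => by rw [mul_smul]; simp

@[simp] lemma ofIdx_mul_ofIdx_mul (i : ι) (w : P.weylGroup) :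
    weylGroup.ofIdx P i * (weylGroup.ofIdx P i * w) = w := by
  rw [← mul_assoc, ofIdx_mul_self, one_mul]

@[simp] lemma ofIdx_inv (i : ι) : (weylGroup.ofIdx P i)⁻¹ = weylGroup.ofIdx P i :=
  inv_eq_of_mul_eq_one_left (ofIdx_mul_self i)

lemma ofIdx_ne_one (i : ι) : weylGroup.ofIdx P i ≠ 1 := fun h =>
  negIdx_ne (P := P) i (by rw [← ofIdx_smul_self, h, one_smul])

@[simp] lemma ofIdx_negIdx (i : ι) : weylGroup.ofIdx P (negIdx P i) = weylGroup.ofIdx P i :=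
  weylGroup_ext fun m => by simp [reflection_apply]

lemma ofIdx_smul_weight (i : ι) (m : M) :
    weylGroup.ofIdx P i • m = m - P.toLinearMap m (P.coroot i) • P.root i := by
  simp [reflection_apply]

lemma ofIdx_smul (w : P.weylGroup) (i : ι) :
    weylGroup.ofIdx P (w • i) = w * weylGroup.ofIdx P i * w⁻¹ := by
  obtain ⟨w, hw⟩ := w
  induction hw using weylGroup.induction generalizing i with
  | mem j =>
    change weylGroup.ofIdx P (P.reflectionPerm j i) =
      weylGroup.ofIdx P j * weylGroup.ofIdx P i * (weylGroup.ofIdx P j)⁻¹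
    rw [ofIdx_inv]
    refine weylGroup_ext fun m => ?_
    rw [mul_smul, mul_smul]
    simp [reflection_reflectionPerm]
  | one =>
    change weylGroup.ofIdx P ((1 : P.weylGroup) • i) = 1 * weylGroup.ofIdx P i * 1⁻¹
    simp
  | mul x y hx hy ihx ihy =>
    change weylGroup.ofIdx P (((⟨x, hx⟩ : P.weylGroup) * ⟨y, hy⟩) • i) =
      ((⟨x, hx⟩ : P.weylGroup) * ⟨y, hy⟩) * weylGroup.ofIdx P i *
        ((⟨x, hx⟩ : P.weylGroup) * ⟨y, hy⟩)⁻¹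
    rw [mul_smul, ihx, ihy]
    group

lemma ofIdx_mul_eq (w : P.weylGroup) (i : ι) :
    weylGroup.ofIdx P i * w = w * weylGroup.ofIdx P (w⁻¹ • i) := by
  rw [ofIdx_smul]; group

/-- In a reduced root system, a reflection determines its root up to sign. -/
lemma eq_or_eq_negIdx_of_ofIdx_eq [P.IsReduced] {i j : ι}
    (h : weylGroup.ofIdx P i = weylGroup.ofIdx P j) : i = j ∨ i = negIdx P j := by
  by_contra! hc
  have hli := IsReduced.linearIndependent P hc.1 (fun h' => hc.2 (by simpa [negIdx] using h'))
  have h1 := ofIdx_smul_weight (P := P) i (P.root j)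
  have h2 := ofIdx_smul_weight (P := P) j (P.root j)
  rw [h, h2] at h1
  simp only [root_coroot_eq_pairing, pairing_same] at h1
  have := LinearIndependent.pair_iff.1 hli (-P.pairing j i) 2 (by
    rw [neg_smul, neg_add_eq_zero]
    exact (sub_right_inj.1 h1).symm)
  norm_num at this

/-! ### Lengths -/

section Length

variable (b : P.Base)

/-- The set in the definition of `length` is not empty. -/
lemma exists_word [Finite ι] [P.IsCrystallographic] [P.IsReduced] (w : P.weylGroup) :
    ∃ s : List ι, (∀ i ∈ s, i ∈ b.support) ∧ (s.map (weylGroup.ofIdx P)).prod = w := by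
  obtain ⟨w, hw⟩ := w
  induction hw using weylGroup.induction with
  | mem i =>
    change ∃ s : List ι, _ ∧ _ = weylGroup.ofIdx P i
    refine b.induction_reflect (p := fun i => ∃ s : List ι, (∀ j ∈ s, j ∈ b.support) ∧
      (s.map (weylGroup.ofIdx P)).prod = weylGroup.ofIdx P i) i ?_ ?_ ?_
    · rintro i ⟨s, hs, h⟩
      exact ⟨s, hs, by rw [h]; exact (ofIdx_negIdx i).symm⟩
    · exact fun i hi => ⟨[i], by simpa using hi, by simp⟩
    · rintro i j ⟨s, hs, h⟩ hj
      refine ⟨j :: s ++ [j], by simpa [or_imp, forall_and, hj] using hs, ?_⟩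
      rw [← ofIdx_smul_idx, ofIdx_smul, ofIdx_inv]
      simp [h, mul_assoc]
  | one => exact ⟨[], by simp, rfl⟩
  | mul x y hx hy ihx ihy =>
    obtain ⟨s, hs, h⟩ := ihx
    obtain ⟨t, ht, h'⟩ := ihy
    refine ⟨s ++ t, by simpa [or_imp, forall_and] using ⟨hs, ht⟩, ?_⟩
    rw [List.map_append, List.prod_append, h, h']
    rfl

lemma length_le_of_word {w : P.weylGroup} {s : List ι} (hs : ∀ i ∈ s, i ∈ b.support)
    (h : (s.map (weylGroup.ofIdx P)).prod = w) : length b w ≤ s.length :=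
  Nat.sInf_le ⟨s, rfl, hs, h⟩

variable [Finite ι] [P.IsCrystallographic] [P.IsReduced]

lemma exists_reduced_word (w : P.weylGroup) :
    ∃ s : List ι, s.length = length b w ∧ (∀ i ∈ s, i ∈ b.support) ∧
      (s.map (weylGroup.ofIdx P)).prod = w := by
  obtain ⟨s, hs, h⟩ := exists_word b w
  exact Nat.sInf_mem (s := {n : ℕ | ∃ s : List ι, s.length = n ∧ (∀ i ∈ s, i ∈ b.support) ∧
    (s.map (weylGroup.ofIdx P)).prod = w}) ⟨_, s, rfl, hs, h⟩

/-- The exchange property: if `w` makes the simple root `γ` negative, then a word for `w s_γ` is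
obtained from any word for `w` by deleting a letter. It holds because a simple reflection permutes
the positive roots different from its own root. -/
lemma exists_word_exchange {γ : ι} (hγ : γ ∈ b.support) (s : List ι)
    (hs : ∀ i ∈ s, i ∈ b.support) (h : ¬ b.IsPos ((s.map (weylGroup.ofIdx P)).prod • γ)) :
    ∃ t : List ι, t.length + 1 = s.length ∧ (∀ i ∈ t, i ∈ b.support) ∧
      (t.map (weylGroup.ofIdx P)).prod =
        (s.map (weylGroup.ofIdx P)).prod * weylGroup.ofIdx P γ := by
  induction s with
  | nil => simp [Base.isPos_of_mem_support hγ] at h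
  | cons j s ih =>
    simp only [List.mem_cons, forall_eq_or_imp] at hs
    by_cases hp : b.IsPos ((s.map (weylGroup.ofIdx P)).prod • γ)
    · refine ⟨s, rfl, hs.2, ?_⟩
      have hj : (s.map (weylGroup.ofIdx P)).prod • γ = j := by
        by_contra hne
        refine h ?_
        rw [List.map_cons, List.prod_cons, mul_smul, ofIdx_smul_idx]
        exact hp.reflectionPerm hs.1 hne
      rw [List.map_cons, List.prod_cons, ← hj, ofIdx_smul]
      simp [mul_assoc]
    · obtain ⟨t, h1, h2, h3⟩ := ih hs.2 hp
      exact ⟨j :: t, by simpa using h1, by simpa using ⟨hs.1, h2⟩, by simp [h3, mul_assoc]⟩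

lemma length_mul_ofIdx_le (w : P.weylGroup) {γ : ι} (hγ : γ ∈ b.support) :
    length b (w * weylGroup.ofIdx P γ) ≤ length b w + 1 := by
  obtain ⟨s, h1, h2, h3⟩ := exists_reduced_word b w
  rw [← h1, ← h3]
  refine (length_le_of_word b (s := s ++ [γ]) ?_ (by simp)).trans (by simp)
  simpa [or_imp, forall_and, hγ] using h2

lemma length_mul_ofIdx_add_one (w : P.weylGroup) {γ : ι} (hγ : γ ∈ b.support)
    (h : ¬ b.IsPos (w • γ)) : length b (w * weylGroup.ofIdx P γ) + 1 = length b w := by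
  obtain ⟨s, h1, h2, h3⟩ := exists_reduced_word b w
  obtain ⟨t, h4, h5, h6⟩ := exists_word_exchange b hγ s h2 (by rwa [h3])
  have := length_le_of_word b h5 (h6.trans (by rw [h3]))
  have h7 := length_mul_ofIdx_le b (w * weylGroup.ofIdx P γ) hγ
  rw [mul_assoc, ofIdx_mul_self, mul_one] at h7
  omega

lemma length_mul_ofIdx (w : P.weylGroup) {γ : ι} (hγ : γ ∈ b.support)
    (h : b.IsPos (w • γ)) : length b (w * weylGroup.ofIdx P γ) = length b w + 1 := by
  have := length_mul_ofIdx_add_one b (w * weylGroup.ofIdx P γ) hγ (by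
    rw [mul_smul]; simpa using h)
  rw [mul_assoc, ofIdx_mul_self, mul_one] at this
  exact this.symm

end Length

/-! ### The pairing of `ρ` with coroots -/

section Rho

variable (b : P.Base)

/-- A root whose coroot pairs to `1` with `ρ` is simple. -/
lemma mem_support_of_flip_height {i : ι} (hi : b.flip.height i = 1) : i ∈ b.support := by
  obtain ⟨f, -, hf0, hf⟩ := b.flip.exists_root_eq_sum_int i
  rw [Base.height_eq_sum hf] at hi
  change P.coroot i = ∑ j ∈ b.support, f j • P.coroot j at hf
  change ∑ j ∈ b.support, f j = 1 at hi
  have hnn : 0 ≤ f := by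
    refine (hf0.resolve_right fun h => ?_).le
    have := Finset.sum_nonpos (s := b.support) fun j _ => h.le j
    omega
  obtain ⟨j, hj, hne⟩ := Finset.exists_ne_zero_of_sum_ne_zero (hi.trans_ne one_ne_zero)
  classical
  have hsum := Finset.add_sum_erase b.support f hj
  have hrest := Finset.sum_nonneg (s := b.support.erase j) fun k _ => hnn k
  have hjp := hnn j
  change 0 ≤ f j at hjp
  change 0 ≤ ∑ k ∈ b.support.erase j, f k at hrest
  have hz := (Finset.sum_eq_zero_iff_of_nonneg (s := b.support.erase j) fun k _ => hnn k).1
    (by omega)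
  rw [← Finset.add_sum_erase _ _ hj, Finset.sum_eq_zero fun k hk => by rw [hz k hk, zero_smul],
    add_zero, show f j = 1 by omega, one_smul] at hf
  rwa [P.coroot.injective hf]

variable [Finite ι] [P.IsCrystallographic] [P.IsReduced]

/-- A simple reflection permutes the positive roots other than its own, so that their contributions
to the pairing of `2ρ` with the simple coroot cancel. -/
lemma rho_coroot_of_mem_support {γ : ι} (hγ : γ ∈ b.support) :
    P.toLinearMap (rho b) (P.coroot γ) = 1 := by
  classical
  have := Fintype.ofFinite ι
  have hset : {i : ι | b.IsPos i} = (({i | b.IsPos i} : Finset ι) : Set ι) := by simp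
  rw [rho, hset, finsum_mem_coe_finset]
  simp only [map_smul, map_sum, LinearMap.smul_apply, LinearMap.sum_apply, root_coroot_eq_pairing]
  rw [← Finset.add_sum_erase _ _ (a := γ) (by simpa using Base.isPos_of_mem_support hγ)]
  rw [Finset.sum_involution (fun i _ => P.reflectionPerm γ i)]
  · simp
  · intro i hi
    simp [← pairing_reflectionPerm]
  · intro i hi h h'
    have := P.pairing_reflectionPerm γ i γ
    rw [h', pairing_reflectionPerm_self_right] at this
    exact h (by linarith)
  · intro i hi
    simp only [Finset.mem_erase, Finset.mem_filter, Finset.mem_univ, true_and] at hi ⊢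
    refine ⟨fun h => ?_, hi.2.reflectionPerm hγ hi.1⟩
    have h2 : i = negIdx P γ := (P.reflectionPerm γ).injective (by rw [h, negIdx]; simp)
    rw [h2] at hi
    simp [Base.isPos_of_mem_support hγ] at hi
  · intro i hi
    simp

lemma rho_coroot (i : ι) : P.toLinearMap (rho b) (P.coroot i) = b.flip.height i := by
  obtain ⟨f, -, -, hf⟩ := b.flip.exists_root_eq_sum_int i
  rw [Base.height_eq_sum hf]
  change P.coroot i = ∑ j ∈ b.support, f j • P.coroot j at hf
  rw [hf, map_sum, Int.cast_sum]
  refine Finset.sum_congr rfl fun j hj => ?_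
  rw [map_zsmul, rho_coroot_of_mem_support b hj]
  simp

/-- The coroot of a positive root is positive. -/
lemma flip_isPos {i : ι} (hi : b.IsPos i) : b.flip.IsPos i := by
  have : Module.IsReflexive ℝ N := .of_isPerfPair P.flip.toLinearMap
  refine hi.induction_on_reflect (p := fun i => b.IsPos i → b.flip.IsPos i)
    (fun j hj _ => Base.isPos_of_mem_support (b := b.flip) hj) (fun i j ih hj hpos => ?_) hi
  by_cases hi : b.IsPos i
  · refine (ih hi).reflectionPerm (b := b.flip) hj ?_
    rintro rfl
    exact (isPos_negIdx b i).1 hpos hi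
  · have h : negIdx P i = j := by
      by_contra hne
      have := ((isPos_negIdx b i).2 hi).reflectionPerm hj hne
      rw [← ofIdx_smul_idx, smul_negIdx, isPos_negIdx] at this
      exact this hpos
    rw [← h, ← ofIdx_smul_idx, ofIdx_negIdx, ofIdx_smul_self, h]
    exact Base.isPos_of_mem_support (b := b.flip) hj

end Rho

/-! ### Edges of the quantum Bruhat graph -/

section Edges

variable (b : P.Base)

lemma length_lt_of_bruhatLT {x y : P.weylGroup} (h : BruhatLT b x y) :
    length b x < length b y := by
  induction h with
  | single h => exact h.2
  | tail _ h ih => exact ih.trans h.2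

lemma bruhatLT_ofIdx_mul_iff (v : P.weylGroup) (i : ι) :
    BruhatLT b v (weylGroup.ofIdx P i * v) ↔ length b v < length b (weylGroup.ofIdx P i * v) :=
  ⟨length_lt_of_bruhatLT b, fun h => .single ⟨⟨_, ofIdx_mul_eq v i⟩, h⟩⟩

lemma ofIdx_mul_bruhatLT_iff (v : P.weylGroup) (i : ι) :
    BruhatLT b (weylGroup.ofIdx P i * v) v ↔ length b (weylGroup.ofIdx P i * v) < length b v := by
  simpa using bruhatLT_ofIdx_mul_iff b (weylGroup.ofIdx P i * v) i

/-- The left multiplication of `v` by the reflection of index `i` is along an edge of the quantum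
Bruhat graph. -/
def CanMove (v : P.weylGroup) (i : ι) : Prop := ∃ j, IsEdge b v j (weylGroup.ofIdx P i * v)

@[simp] lemma canMove_negIdx (v : P.weylGroup) (i : ι) :
    CanMove b v (negIdx P i) ↔ CanMove b v i := by simp [CanMove]

variable [Finite ι] [P.IsCrystallographic] [P.IsReduced]

lemma IsEdge.length_cases {x y : P.weylGroup} {j : ι} (h : IsEdge b x j y) :
    length b y = length b x + 1 ∨
      (length b y : ℤ) = length b x - 2 * b.flip.height j + 1 := by
  refine h.2.2.imp_right fun h' => ?_
  rw [rho_coroot] at h'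
  exact_mod_cast h'

lemma CanMove.length_ne {v : P.weylGroup} {i : ι} (h : CanMove b v i) :
    length b (weylGroup.ofIdx P i * v) ≠ length b v := by
  obtain ⟨j, hj⟩ := h
  have := hj.length_cases
  omega

/-- If the quantum Bruhat graph has edges in both directions between `v` and `s_α v`, then `±v⁻¹ α`
is simple: one of the edges is a quantum edge, and comparing lengths shows that the coroot pairs to
`1` with `ρ`. -/
lemma mem_support_of_canMove {v : P.weylGroup} {i : ι} (h : CanMove b v i)
    (h' : CanMove b (weylGroup.ofIdx P i * v) i) :
    v⁻¹ • i ∈ b.support ∨ negIdx P (v⁻¹ • i) ∈ b.support := by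
  obtain ⟨j, hj⟩ := h
  obtain ⟨k, hk⟩ := h'
  rw [ofIdx_mul_ofIdx_mul] at hk
  have hj1 : weylGroup.ofIdx P j = weylGroup.ofIdx P (v⁻¹ • i) := by
    have := hj.2.1
    rw [ofIdx_mul_eq] at this
    exact (mul_left_cancel this).symm
  have hjk : weylGroup.ofIdx P j = weylGroup.ofIdx P k := by
    have := hk.2.1
    rw [hj.2.1, mul_assoc, eq_comm, mul_eq_left, mul_eq_one_iff_eq_inv, ofIdx_inv] at this
    exact this
  have hkj : k = j := (eq_or_eq_negIdx_of_ofIdx_eq hjk.symm).resolve_right fun h => by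
    have := hk.1
    rw [h, isPos_negIdx] at this
    exact this hj.1
  subst hkj
  have hpos := flip_isPos b hk.1
  rw [Base.isPos_iff] at hpos
  have h1 := hj.length_cases
  have h2 := hk.length_cases
  have := mem_support_of_flip_height b (i := k) (by omega)
  rcases eq_or_eq_negIdx_of_ofIdx_eq hj1 with h | h
  · exact .inl (h ▸ this)
  · exact .inr (h ▸ this)

lemma length_ofIdx_mul {v : P.weylGroup} {i : ι} (hi : v⁻¹ • i ∈ b.support)
    (h : b.IsPos i) : length b (weylGroup.ofIdx P i * v) = length b v + 1 := by
  rw [ofIdx_mul_eq]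
  exact length_mul_ofIdx b v hi (by simpa using h)

lemma length_ofIdx_mul_add_one {v : P.weylGroup} {i : ι} (hi : v⁻¹ • i ∈ b.support)
    (h : ¬ b.IsPos i) : length b (weylGroup.ofIdx P i * v) + 1 = length b v := by
  rw [ofIdx_mul_eq]
  exact length_mul_ofIdx_add_one b v hi (by simpa using h)

lemma canMove_of_mem_support {v : P.weylGroup} {i : ι} (hi : v⁻¹ • i ∈ b.support) :
    CanMove b v i := by
  refine ⟨v⁻¹ • i, Base.isPos_of_mem_support hi, ofIdx_mul_eq v i, ?_⟩
  by_cases h : b.IsPos i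
  · exact .inl (length_ofIdx_mul b hi h)
  · right
    rw [rho_coroot_of_mem_support b hi, ← length_ofIdx_mul_add_one b hi h]
    push_cast
    ring

end Edges

/-! ### Positions of alcoves relative to the hyperplanes -/

section Alcoves

variable (P) in
/-- `k i` is the integer part of `⟨ν, α_i^∨⟩` for all points `ν` of `A`, and none of these numbers
is an integer. An alcove has such a function `k`. -/
def HasFloor (A : Set M) (k : ι → ℤ) : Prop :=
  ∀ ν ∈ A, ∀ i, (k i : ℝ) < P.toLinearMap ν (P.coroot i) ∧
    P.toLinearMap ν (P.coroot i) < k i + 1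

lemma HasFloor.negIdx {A : Set M} {k : ι → ℤ} (hA : A.Nonempty) (h : HasFloor P A k) (i : ι) :
    k (negIdx P i) = -k i - 1 := by
  obtain ⟨ν, hν⟩ := hA
  have h1 := h ν hν i
  have h2 := h ν hν (QuantumWalk.negIdx P i)
  rw [coroot_negIdx, map_neg] at h2
  have h3 : (k (QuantumWalk.negIdx P i) : ℝ) < -k i := by linarith
  have h4 : (-k i - 1 : ℝ) < k (QuantumWalk.negIdx P i) + 1 := by linarith
  norm_cast at h3 h4
  omega

/-- A hyperplane can only lie in one which belongs to the same root up to sign, since the root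
system is reduced. -/
lemma hyperplane_not_subset [Finite ι] [P.IsReduced] {i j : ι} (h : j ≠ i)
    (h' : j ≠ negIdx P i) (k l : ℤ) : ¬ hyperplane P i k ⊆ hyperplane P j l := by
  have : Module.IsReflexive ℝ M := .of_isPerfPair P.toLinearMap
  have : IsAddTorsionFree M := .of_isTorsionFree ℝ M
  intro hsub
  have hli := IsReduced.linearIndependent P h (fun h'' => h' (by simpa [negIdx] using h''))
  refine P.coxeterWeight_ne_four_of_linearIndependent hli ?_
  have h0 := @hsub ((k / 2 : ℝ) • P.root i) (by simp [hyperplane])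
  have h1 := @hsub ((k / 2 : ℝ) • P.root i + (P.root j - (P.pairing j i / 2) • P.root i))
    (by simp [hyperplane])
  simp only [hyperplane, Set.mem_ofPred_eq, map_add, map_sub, map_smul, LinearMap.add_apply,
    LinearMap.sub_apply, LinearMap.smul_apply, root_coroot_eq_pairing, pairing_same,
    smul_eq_mul] at h0 h1
  rw [coxeterWeight]
  linarith

variable [TopologicalSpace M]

lemma IsAlcove.nonempty {A : Set M} (h : IsAlcove P A) : A.Nonempty := by
  obtain ⟨ν, hν, rfl⟩ := h
  exact ⟨ν, mem_connectedComponentIn hν⟩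

variable [IsTopologicalAddGroup M] [ContinuousSMul ℝ M] [T2Space M] [Finite ι] [P.IsRootSystem]

lemma continuous_pairing (y : N) : Continuous fun ν : M => P.toLinearMap ν y := by
  have : FiniteDimensional ℝ M := by
    have h : P.rootSpan ℝ = ⊤ := IsRootSystem.span_root_eq_top
    exact ⟨h ▸ Submodule.fg_span (Set.finite_range _)⟩
  exact (P.toLinearMap.flip y).continuous_of_finiteDimensional

lemma IsAlcove.exists_hasFloor {A : Set M} (h : IsAlcove P A) : ∃ k, HasFloor P A k := by
  obtain ⟨ν, hν, rfl⟩ := h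
  refine ⟨fun i => ⌊P.toLinearMap ν (P.coroot i)⌋, fun x hx i => ?_⟩
  set A := connectedComponentIn (⋃ (i : ι) (k : ℤ), hyperplane P i k)ᶜ ν
  have hsub : A ⊆ (⋃ (i : ι) (k : ℤ), hyperplane P i k)ᶜ := connectedComponentIn_subset _ _
  have hconn : ((fun ν : M => P.toLinearMap ν (P.coroot i)) '' A).OrdConnected :=
    (isPreconnected_connectedComponentIn.image _
      (continuous_pairing (P := P) (P.coroot i)).continuousOn).ordConnected
  have hν' : ν ∈ A := mem_connectedComponentIn hν
  have hint (k : ℤ) : (k : ℝ) ∉ (fun ν : M => P.toLinearMap ν (P.coroot i)) '' A := by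
    rintro ⟨y, hy, hk⟩
    exact hsub hy (Set.mem_iUnion₂.2 ⟨i, k, hk⟩)
  constructor
  · by_contra! hlt
    exact hint _ (hconn.out ⟨x, hx, rfl⟩ ⟨ν, hν', rfl⟩ ⟨hlt, Int.floor_le _⟩)
  · by_contra! hlt
    refine hint (⌊P.toLinearMap ν (P.coroot i)⌋ + 1)
      (hconn.out ⟨ν, hν', rfl⟩ ⟨x, hx, rfl⟩ ⟨?_, ?_⟩)
    · push_cast; exact (Int.lt_floor_add_one _).le
    · push_cast; exact hlt

lemma HasFloor.closure {A : Set M} {k : ι → ℤ} (h : HasFloor P A k) {x : M}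
    (hx : x ∈ closure A) (i : ι) :
    (k i : ℝ) ≤ P.toLinearMap x (P.coroot i) ∧ P.toLinearMap x (P.coroot i) ≤ k i + 1 :=
  closure_minimal (s := A) (t := {x | (k i : ℝ) ≤ P.toLinearMap x (P.coroot i) ∧
      P.toLinearMap x (P.coroot i) ≤ k i + 1}) (fun ν hν => ⟨(h ν hν i).1.le, (h ν hν i).2.le⟩)
    ((isClosed_le continuous_const (continuous_pairing _)).inter
      (isClosed_le (continuous_pairing _) continuous_const)) hx

variable (P) in
open scoped Classical in
/-- The effect of crossing a wall in the direction of the root of index `i` on the integer parts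
of the pairings with the coroots. -/
def bump (k : ι → ℤ) (i : ι) : ι → ℤ := fun j =>
  if j = i then k j + 1 else if j = negIdx P i then k j - 1 else k j

/-- If `A → B` crosses `H_{α,l}`, only the integer parts for `±α` change: the common wall spans
`H_{α,l}`, and would lie in another hyperplane if another integer part changed. -/
lemma Crosses.floor [P.IsReduced] {A B : Set M} {i : ι} {l : ℤ} (h : Crosses P A i l B)
    (hA : A.Nonempty) (hB : B.Nonempty) {k k' : ι → ℤ} (hk : HasFloor P A k)
    (hk' : HasFloor P B k') : l = k i + 1 ∧ k' = bump P k i := by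
  obtain ⟨x, hxA, hxH⟩ : (closure A ∩ hyperplane P i l).Nonempty := by
    rw [← affineSpan_nonempty ℝ, h.wall]
    exact ⟨(l / 2 : ℝ) • P.root i, by simp [hyperplane]⟩
  have hxB : x ∈ closure B := (h.common.subset ⟨hxA, hxH⟩).1
  change P.toLinearMap x (P.coroot i) = l at hxH
  have hl : l = k i + 1 := by
    obtain ⟨ν, hν⟩ := hA
    have h1 : (k i : ℝ) < l := (hk ν hν i).1.trans (h.left ν hν)
    have h2 : (l : ℝ) ≤ k i + 1 := hxH ▸ (hk.closure hxA i).2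
    norm_cast at h1 h2
    omega
  have hl' : l = k' i := by
    obtain ⟨ν, hν⟩ := hB
    have h1 : (l : ℝ) < k' i + 1 := (h.right ν hν).trans (hk' ν hν i).2
    have h2 : (k' i : ℝ) ≤ l := hxH ▸ (hk'.closure hxB i).1
    norm_cast at h1 h2
    omega
  refine ⟨hl, funext fun j => ?_⟩
  unfold bump
  split_ifs with h1 h2
  · subst h1; omega
  · subst h2
    rw [hk.negIdx hA, hk'.negIdx hB]
    omega
  · by_contra hne
    obtain ⟨c, hc⟩ : ∃ c : ℤ, closure A ∩ hyperplane P i l ⊆ hyperplane P j c := by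
      rcases lt_or_gt_of_ne hne with hlt | hlt
      · refine ⟨k j, fun y hy => ?_⟩
        have hle : (k' j + 1 : ℝ) ≤ k j := by exact_mod_cast hlt
        exact le_antisymm ((hk'.closure (h.common.subset hy).1 j).2.trans hle)
          (hk.closure hy.1 j).1
      · refine ⟨k' j, fun y hy => ?_⟩
        have hle : (k j + 1 : ℝ) ≤ k' j := by exact_mod_cast hlt
        exact le_antisymm ((hk.closure hy.1 j).2.trans hle)
          (hk'.closure (h.common.subset hy).1 j).1
    refine hyperplane_not_subset h1 h2 l c ?_
    rw [← h.wall]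
    let S : AffineSubspace ℝ M :=
      { carrier := hyperplane P j c
        smul_vsub_vadd_mem' := fun a p q r hp hq hr => by
          simp only [hyperplane, Set.mem_ofPred_eq] at hp hq hr ⊢
          simp [hp, hq, hr] }
    exact (affineSpan_le (Q := S)).2 hc

end Alcoves

/-! ### The hyperplanes crossed by an alcove path -/

section Levels

variable (P) in
/-- The sequence of pairs `(γ_t, l_t)` determined by the sequence of roots `γ_t`, where `k` records
the position of the first alcove. -/
def levels : (ι → ℤ) → List ι → List (ι × ℤ)
  | _, [] => []
  | k, i :: s => (i, k i + 1) :: levels (bump P k i) s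

lemma levels_append (k : ι → ℤ) (s t : List ι) :
    levels P k (s ++ t) = levels P k s ++ levels P (s.foldl (bump P) k) t := by
  induction s generalizing k with
  | nil => rfl
  | cons i s ih => simp [levels, ih]

lemma bump_negIdx_apply {k : ι → ℤ} (hk : ∀ i, k (negIdx P i) = -k i - 1) (j i : ι) :
    bump P k j (negIdx P i) = -bump P k j i - 1 := by
  have h1 := negIdx_ne (P := P) i
  have h2 : negIdx P i = j ↔ i = negIdx P j :=
    ⟨fun h => by rw [← h, negIdx_negIdx], fun h => by rw [h, negIdx_negIdx]⟩
  have h3 : negIdx P i = negIdx P j ↔ i = j :=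
    ⟨fun h => by rw [← negIdx_negIdx (P := P) i, h, negIdx_negIdx], fun h => by rw [h]⟩
  have h4 := negIdx_ne (P := P) j
  unfold bump
  rw [h2, h3, hk]
  split_ifs <;> first | omega | (exfalso; simp_all)

lemma foldl_bump_negIdx_apply {k : ι → ℤ} (hk : ∀ i, k (negIdx P i) = -k i - 1) (s : List ι)
    (i : ι) : s.foldl (bump P) k (negIdx P i) = -s.foldl (bump P) k i - 1 := by
  induction s generalizing k with
  | nil => exact hk i
  | cons j s ih => exact ih (bump_negIdx_apply hk j)

lemma bump_bump_negIdx (k : ι → ℤ) (i : ι) : bump P (bump P k i) (negIdx P i) = k := by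
  have := negIdx_ne (P := P) i
  funext j
  unfold bump
  rw [negIdx_negIdx]
  split_ifs <;> grind

lemma levels_cancel {k : ι → ℤ} (hk : ∀ i, k (negIdx P i) = -k i - 1) (s₁ s₂ : List ι) (i : ι) :
    ∃ l : ℤ, levels P k (s₁ ++ i :: negIdx P i :: s₂) =
      levels P k s₁ ++ (i, l) :: (negIdx P i, -l) :: levels P (s₁.foldl (bump P) k) s₂ := by
  refine ⟨s₁.foldl (bump P) k i + 1, ?_⟩
  rw [levels_append]
  simp only [levels, bump_bump_negIdx]
  rw [bump_negIdx_apply (foldl_bump_negIdx_apply hk s₁)]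
  simp only [bump, if_true]
  congr 4
  omega

variable [TopologicalSpace M] [IsTopologicalAddGroup M] [ContinuousSMul ℝ M] [T2Space M]
  [Finite ι] [P.IsRootSystem] [P.IsReduced]

lemma ofFn_eq_levels {m : ℕ} (A : Fin (m + 1) → Set M) (γ : Fin m → ι) (l : Fin m → ℤ)
    (hA : ∀ t, IsAlcove P (A t))
    (hcr : ∀ t : Fin m, Crosses P (A t.castSucc) (γ t) (l t) (A t.succ))
    {k : ι → ℤ} (hk : HasFloor P (A 0) k) :
    (List.ofFn fun t => (γ t, l t)) = levels P k (List.ofFn γ) := by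
  induction m generalizing k with
  | zero => simp [levels]
  | succ m ih =>
    obtain ⟨k', hk'⟩ := (hA 1).exists_hasFloor
    obtain ⟨h1, h2⟩ := (hcr 0).floor (hA _).nonempty (hA _).nonempty hk hk'
    rw [List.ofFn_succ, List.ofFn_succ, levels, h1, ← h2]
    congr 1
    exact ih (fun t => A t.succ) (fun t => γ t.succ) (fun t => l t.succ) (fun t => hA _)
      (fun t => hcr t.succ) hk'

/-- Deleting a segment `α, -α` from the roots of an alcove path deletes a segment
`(α, l), (-α, -l)` from its sequence of pairs `(γ_t, l_t)`, and does not change the other pairs. -/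
lemma IsDeletion.exists_levels {b : P.Base} {μ : M} {Γ Ξ : AlcovePath b μ}
    (h : IsDeletion b Γ Ξ) :
    ∃ (s₁ s₂ : List (ι × ℤ)) (i : ι) (l : ℤ),
      (List.ofFn fun t => (Γ.γ t, Γ.l t)) = s₁ ++ (i, l) :: (negIdx P i, -l) :: s₂ ∧
      (List.ofFn fun t => (Ξ.γ t, Ξ.l t)) = s₁ ++ s₂ := by
  obtain ⟨s₁, s₂, i, hΓ, hΞ⟩ := h
  obtain ⟨k, hk⟩ := (Γ.isAlcove 0).exists_hasFloor
  have hk' : HasFloor P (Ξ.alcove 0) k := by rwa [Ξ.start, ← Γ.start]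
  obtain ⟨l, hl⟩ := levels_cancel (hk.negIdx (Γ.isAlcove 0).nonempty) s₁ s₂ i
  refine ⟨levels P k s₁, levels P (s₁.foldl (bump P) k) s₂, i, l, ?_, ?_⟩
  · rw [ofFn_eq_levels _ _ _ Γ.isAlcove Γ.crosses hk, hΓ, hl]
  · rw [ofFn_eq_levels _ _ _ Ξ.isAlcove Ξ.crosses hk', hΞ, levels_append]

end Levels

/-! ### Decorated walks as sequences of choices -/

/-- The possibilities for a step of a decorated walk: not to move, with decoration `0` (or no
decoration at all), not to move, with decoration `1`, or to move. -/
inductive Choice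
  | stay
  | stayOne
  | move

open Choice

/-- The choice `c` is possible at `v`, for a step with the root of index `i`. -/
def Choice.Ok (b : P.Base) (v : P.weylGroup) (i : ι) : Choice → Prop
  | stay => True
  | stayOne => negIdx P (v⁻¹ • i) ∈ b.support
  | move => CanMove b v i

/-- The position after a step from `v`. -/
def Choice.next (v : P.weylGroup) (i : ι) : Choice → P.weylGroup
  | move => weylGroup.ofIdx P i * v
  | _ => v

/-- All choices in a sequence of steps beginning at `v` are possible. -/
def Valid (b : P.Base) : P.weylGroup → List ((ι × ℤ) × Choice) → Prop
  | _, [] => True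
  | v, s :: a => s.2.Ok b v s.1.1 ∧ Valid b (s.2.next v s.1.1) a

/-- The position after a sequence of steps beginning at `v`. -/
def endpoint (v : P.weylGroup) (a : List ((ι × ℤ) × Choice)) : P.weylGroup :=
  a.foldl (fun v s => s.2.next v s.1.1) v

lemma valid_append (b : P.Base) (v : P.weylGroup) (a a' : List ((ι × ℤ) × Choice)) :
    Valid b v (a ++ a') ↔ Valid b v a ∧ Valid b (endpoint v a) a' := by
  induction a generalizing v with
  | nil => simp [Valid, endpoint]
  | cons s a ih => simp [Valid, endpoint, ih, and_assoc]

variable (P) in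
/-- The statistics of an initial part of a decorated walk: position, sign, `qwt`, `qwt^∨`, weight
`r̂_t μ`, and the part of `deg'` contributed by the steps so far. Only the value of `r̂_t` at `μ` is
recorded: the linear part of `r̂_t` is the inverse of the position. -/
structure State where
  pos : P.weylGroup
  sign : ℤ
  q : M
  qCo : N
  wt : M
  d : ℝ

/-- The state with the opposite sign. -/
def State.flipSign (σ : State P) : State P := { σ with sign := -σ.sign }

open scoped Classical in
/-- The factor of the sign contributed by moving from `v` along the root of index `i`. -/
def moveSign (b : P.Base) (v : P.weylGroup) (i : ι) : ℤ :=
  (if ¬ b.IsPos i ∧ length b (weylGroup.ofIdx P i * v) < length b v then -1 else 1) *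
    if b.IsPos i ∧ length b v < length b (weylGroup.ofIdx P i * v) then -1 else 1

/-- `1` if moving from `v` along the root of index `i` decreases the length, `0` otherwise. -/
def descent (b : P.Base) (v : P.weylGroup) (i : ι) : ℤ :=
  if length b (weylGroup.ofIdx P i * v) < length b v then 1 else 0

/-- The effect of a step on the statistics. -/
def State.step (b : P.Base) (μ : M) (σ : State P) (s : (ι × ℤ) × Choice) : State P :=
  let l' : ℝ := P.toLinearMap μ (P.coroot s.1.1) - s.1.2
  let j := σ.pos⁻¹ • s.1.1
  match s.2 with
  | stay => σ
  | stayOne => { σ with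
      sign := -σ.sign
      q := σ.q - P.root j
      qCo := σ.qCo - P.coroot j
      d := σ.d - l' }
  | move =>
    let qCo' := σ.qCo + descent b σ.pos s.1.1 • P.coroot (absIdx b j)
    { pos := weylGroup.ofIdx P s.1.1 * σ.pos
      sign := σ.sign * moveSign b σ.pos s.1.1
      q := σ.q + descent b σ.pos s.1.1 • P.root (absIdx b j)
      qCo := qCo'
      wt := σ.wt - l' • P.root j
      d := σ.d + P.toLinearMap (-(l' • P.root j)) qCo' -
        descent b σ.pos s.1.1 * (sgn b s.1.1 * l') }

/-- The statistics after a sequence of steps. -/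
def State.run (b : P.Base) (μ : M) (σ : State P) (a : List ((ι × ℤ) × Choice)) : State P :=
  a.foldl (State.step b μ) σ

lemma State.run_append (b : P.Base) (μ : M) (σ : State P) (a a' : List ((ι × ℤ) × Choice)) :
    σ.run b μ (a ++ a') = (σ.run b μ a).run b μ a' := List.foldl_append

lemma State.pos_step (b : P.Base) (μ : M) (σ : State P) (s : (ι × ℤ) × Choice) :
    (σ.step b μ s).pos = s.2.next σ.pos s.1.1 := by
  obtain ⟨x, _ | _ | _⟩ := s <;> rfl

lemma State.pos_run (b : P.Base) (μ : M) (σ : State P) (a : List ((ι × ℤ) × Choice)) :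
    (σ.run b μ a).pos = endpoint σ.pos a := by
  induction a generalizing σ with
  | nil => rfl
  | cons s a ih =>
    change ((σ.step b μ s).run b μ a).pos = endpoint (s.2.next σ.pos s.1.1) a
    rw [ih, State.pos_step]

lemma State.step_flipSign (b : P.Base) (μ : M) (σ : State P) (s : (ι × ℤ) × Choice) :
    σ.flipSign.step b μ s = (σ.step b μ s).flipSign := by
  obtain ⟨x, _ | _ | _⟩ := s <;> simp [State.step, State.flipSign]

lemma State.run_flipSign (b : P.Base) (μ : M) (σ : State P) (a : List ((ι × ℤ) × Choice)) :
    σ.flipSign.run b μ a = (σ.run b μ a).flipSign := by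
  induction a generalizing σ with
  | nil => rfl
  | cons s a ih =>
    change (σ.flipSign.step b μ s).run b μ a = ((σ.step b μ s).run b μ a).flipSign
    rw [step_flipSign, ih]

/-! ### Two steps along opposite roots -/

section TwoSteps

variable (b : P.Base)

@[simp] lemma ofIdx_mul_inv_smul (v : P.weylGroup) (i : ι) :
    (weylGroup.ofIdx P i * v)⁻¹ • i = negIdx P (v⁻¹ • i) := by
  rw [mul_inv_rev, mul_smul, ofIdx_inv, ofIdx_smul_self, smul_negIdx]

@[simp] lemma absIdx_negIdx (i : ι) : absIdx b (negIdx P i) = absIdx b i := by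
  by_cases h : b.IsPos i <;> simp [absIdx, h]

@[simp] lemma sgn_negIdx (i : ι) : sgn b (negIdx P i) = -sgn b i := by
  by_cases h : b.IsPos i <;> simp [sgn, h]

@[simp] lemma descent_negIdx (v : P.weylGroup) (i : ι) :
    descent b v (negIdx P i) = descent b v i := by simp [descent]

lemma moveSign_negIdx {v : P.weylGroup} {i : ι}
    (h : length b (weylGroup.ofIdx P i * v) ≠ length b v) :
    moveSign b v (negIdx P i) = -moveSign b v i := by
  unfold moveSign
  by_cases h1 : b.IsPos i <;> rcases lt_or_gt_of_ne h with h2 | h2 <;> simp [h1, h2, h2.not_gt]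

lemma moveSign_mul_moveSign {v : P.weylGroup} {i : ι}
    (h : length b (weylGroup.ofIdx P i * v) ≠ length b v) :
    moveSign b v i * moveSign b (weylGroup.ofIdx P i * v) (negIdx P i) = 1 := by
  unfold moveSign
  by_cases h1 : b.IsPos i <;> rcases lt_or_gt_of_ne h with h2 | h2 <;> simp [h1, h2, h2.not_gt]

variable [Finite ι] [P.IsCrystallographic] [P.IsReduced] (μ : M) (σ : State P) {i : ι} (l : ℤ)

lemma step_stay_move (h : CanMove b σ.pos i) :
    (σ.step b μ ((i, l), stay)).step b μ ((negIdx P i, -l), move) =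
      ((σ.step b μ ((i, l), move)).step b μ ((negIdx P i, -l), stay)).flipSign := by
  simp only [State.step, State.flipSign, ofIdx_negIdx, smul_negIdx, absIdx_negIdx, sgn_negIdx,
    descent_negIdx, root_negIdx, coroot_negIdx, moveSign_negIdx b (h.length_ne b), State.mk.injEq,
    true_and, map_neg, map_smul, LinearMap.neg_apply, LinearMap.smul_apply, smul_eq_mul]
  push_cast
  exact ⟨by ring, by module, by ring⟩

/-- The decoration changes `qwt^∨` by `-j^∨`, where `j = v⁻¹ α`. If the move comes after it, this
adds `l' ⟨j, j^∨⟩ = 2 l'` to the degree, which makes up for the change of `l'` to `-l'`. -/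
lemma step_stayOne_move (h : CanMove b σ.pos i) :
    (σ.step b μ ((i, l), stayOne)).step b μ ((negIdx P i, -l), move) =
      ((σ.step b μ ((i, l), move)).step b μ ((negIdx P i, -l), stayOne)).flipSign := by
  simp only [State.step, State.flipSign, ofIdx_negIdx, smul_negIdx, absIdx_negIdx, sgn_negIdx,
    descent_negIdx, root_negIdx, coroot_negIdx, moveSign_negIdx b (h.length_ne b), State.mk.injEq,
    true_and, map_neg, map_smul, map_add, map_sub, LinearMap.neg_apply, LinearMap.smul_apply,
    smul_eq_mul, ofIdx_mul_inv_smul, neg_neg, root_coroot_eq_pairing, pairing_same]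
  push_cast
  exact ⟨by ring, by abel, by abel, by module, by ring⟩

/-- Exactly one of the two moves is a descent. Its position is determined by the sign of `α`, since
`-v⁻¹ α` is simple. -/
lemma step_move_move_of_neg (h : negIdx P (σ.pos⁻¹ • i) ∈ b.support) :
    (σ.step b μ ((i, l), move)).step b μ ((negIdx P i, -l), move) =
      ((σ.step b μ ((i, l), stayOne)).step b μ ((negIdx P i, -l), stay)).flipSign := by
  have h' : σ.pos⁻¹ • negIdx P i ∈ b.support := by rwa [smul_negIdx]
  have hc : CanMove b σ.pos i := (canMove_negIdx b _ i).1 (canMove_of_mem_support b h')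
  have habs : absIdx b (σ.pos⁻¹ • i) = negIdx P (σ.pos⁻¹ • i) := by
    simp [absIdx, (isPos_negIdx b _).1 (Base.isPos_of_mem_support h)]
  have hs := moveSign_mul_moveSign b (hc.length_ne b)
  simp only [State.step, State.flipSign, ofIdx_negIdx, smul_negIdx, absIdx_negIdx, sgn_negIdx,
    descent_negIdx, root_negIdx, coroot_negIdx, State.mk.injEq,
    map_neg, map_smul, map_add, LinearMap.neg_apply, LinearMap.smul_apply,
    smul_eq_mul, ofIdx_mul_inv_smul, neg_neg, root_coroot_eq_pairing, pairing_same,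
    ofIdx_mul_ofIdx_mul, true_and, mul_assoc, hs, habs, mul_one, map_zsmul, smul_neg]
  unfold descent sgn
  rw [ofIdx_mul_ofIdx_mul]
  by_cases hi : b.IsPos i
  · have hlen := length_ofIdx_mul_add_one b h' (by simpa using hi)
    rw [ofIdx_negIdx] at hlen
    rw [if_pos (by omega), if_neg (by omega), if_pos hi]
    push_cast
    exact ⟨by module, by module, by module, by simp; ring⟩
  · have hlen := length_ofIdx_mul b h' (by simpa using hi)
    rw [ofIdx_negIdx] at hlen
    rw [if_neg (by omega), if_pos (by omega), if_neg hi]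
    push_cast
    exact ⟨by module, by module, by module, by simp; ring⟩

lemma step_move_move (h : σ.pos⁻¹ • i ∈ b.support) :
    (σ.step b μ ((i, l), move)).step b μ ((negIdx P i, -l), move) =
      ((σ.step b μ ((i, l), stay)).step b μ ((negIdx P i, -l), stayOne)).flipSign := by
  have hc : CanMove b σ.pos i := canMove_of_mem_support b h
  have habs : absIdx b (σ.pos⁻¹ • i) = σ.pos⁻¹ • i := by
    simp [absIdx, Base.isPos_of_mem_support h]
  have hs := moveSign_mul_moveSign b (hc.length_ne b)
  simp only [State.step, State.flipSign, ofIdx_negIdx, smul_negIdx, absIdx_negIdx, sgn_negIdx,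
    descent_negIdx, root_negIdx, coroot_negIdx, State.mk.injEq,
    map_neg, map_smul, map_add, LinearMap.neg_apply, LinearMap.smul_apply,
    smul_eq_mul, ofIdx_mul_inv_smul, neg_neg, root_coroot_eq_pairing, pairing_same,
    ofIdx_mul_ofIdx_mul, true_and, mul_assoc, hs, habs, mul_one, map_zsmul, smul_neg]
  unfold descent sgn
  rw [ofIdx_mul_ofIdx_mul]
  by_cases hi : b.IsPos i
  · have hlen := length_ofIdx_mul b h hi
    rw [if_neg (by omega), if_pos (by omega), if_pos hi]
    push_cast
    exact ⟨by module, by module, by module, by simp; ring⟩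
  · have hlen := length_ofIdx_mul_add_one b h hi
    rw [if_pos (by omega), if_neg (by omega), if_neg hi]
    push_cast
    exact ⟨by module, by module, by module, by simp; ring⟩

end TwoSteps

/-! ### The sign-reversing involution -/

section Swap

open scoped Classical in
/-- The involution on the pairs of choices for two steps along `α, -α` beginning at `v`, apart from
the pair consisting of two stationary steps with decorations `0`. -/
def swap (b : P.Base) (v : P.weylGroup) (i : ι) : Choice × Choice → Choice × Choice
  | (move, move) => if v⁻¹ • i ∈ b.support then (stay, stayOne) else (stayOne, stay)
  | (move, c) => (c, move)
  | (c, move) => (move, c)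
  | _ => (move, move)

/-- Both choices are possible, for two steps along `α, -α` beginning at `v`. -/
def PairOk (b : P.Base) (v : P.weylGroup) (i : ι) (c : Choice × Choice) : Prop :=
  c.1.Ok b v i ∧ c.2.Ok b (c.1.next v i) (negIdx P i)

/-- The effect of two steps along `α, -α` on the statistics. -/
def State.twoSteps (b : P.Base) (μ : M) (σ : State P) (i : ι) (l : ℤ) (c : Choice × Choice) :
    State P :=
  (σ.step b μ ((i, l), c.1)).step b μ ((negIdx P i, -l), c.2)

lemma negIdx_notMem_support (b : P.Base) {i : ι} (h : i ∈ b.support) :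
    negIdx P i ∉ b.support := fun h' =>
  (isPos_negIdx b i).1 (Base.isPos_of_mem_support h') (Base.isPos_of_mem_support h)

@[simp] lemma State.flipSign_flipSign (σ : State P) : σ.flipSign.flipSign = σ := by
  simp [State.flipSign]

lemma State.flipSign_comm {σ τ : State P} (h : σ = τ.flipSign) : τ = σ.flipSign := by
  simp [h]

variable (b : P.Base) [Finite ι] [P.IsCrystallographic] [P.IsReduced]

/-- On the possible pairs other than `(stay, stay)`, `swap` is an involution, which reverses the
sign and preserves the other statistics. -/
lemma swap_spec (v : P.weylGroup) (i : ι) (c : Choice × Choice) (hc : c ≠ (stay, stay))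
    (h : PairOk b v i c) :
    PairOk b v i (swap b v i c) ∧ swap b v i c ≠ (stay, stay) ∧ swap b v i (swap b v i c) = c ∧
    ∀ (μ : M) (σ : State P) (l : ℤ), σ.pos = v →
      σ.twoSteps b μ i l (swap b v i c) = (σ.twoSteps b μ i l c).flipSign := by
  obtain ⟨c, c'⟩ := c
  obtain ⟨h1, h2⟩ := h
  rcases c with _ | _ | _ <;> rcases c' with _ | _ | _ <;>
    simp only [Ok, next, ne_eq, not_true_eq_false, canMove_negIdx, smul_negIdx, negIdx_negIdx,
      ofIdx_mul_inv_smul] at h1 h2 hc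
  · -- the pair `(stay, stayOne)`, so that `v⁻¹ α` is simple
    refine ⟨⟨canMove_of_mem_support b h2, ?_⟩, by simp [swap], by simp [swap, h2], ?_⟩
    · simp only [swap, Ok, next, canMove_negIdx]
      rw [← canMove_negIdx]
      exact canMove_of_mem_support b
        (by simpa only [smul_negIdx, ofIdx_mul_inv_smul, negIdx_negIdx])
    · rintro μ σ l rfl
      exact step_move_move b μ σ l h2
  · refine ⟨⟨h2, trivial⟩, by simp [swap], by simp [swap], ?_⟩
    rintro μ σ l rfl
    exact State.flipSign_comm (step_stay_move b μ σ l h2)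
  · -- the pair `(stayOne, stay)`, so that `-v⁻¹ α` is simple
    have hn : v⁻¹ • i ∉ b.support := fun h => negIdx_notMem_support b h h1
    refine ⟨⟨?_, ?_⟩, by simp [swap], by simp [swap, hn], ?_⟩
    · simp only [swap, Ok]
      rw [← canMove_negIdx]
      exact canMove_of_mem_support b (by simpa using h1)
    · simp only [swap, Ok, next, canMove_negIdx]
      exact canMove_of_mem_support b (by simpa only [ofIdx_mul_inv_smul])
    · rintro μ σ l rfl
      exact step_move_move_of_neg b μ σ l h1
  · exact absurd h1 (negIdx_notMem_support b h2)
  · refine ⟨⟨h2, by simpa only [swap, Ok, next, smul_negIdx, ofIdx_mul_inv_smul,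
      negIdx_negIdx]⟩, by simp [swap], by simp [swap], ?_⟩
    rintro μ σ l rfl
    exact State.flipSign_comm (step_stayOne_move b μ σ l h2)
  · refine ⟨⟨trivial, by simpa [swap, Ok, next] using h1⟩, by simp [swap], by simp [swap], ?_⟩
    rintro μ σ l rfl
    exact step_stay_move b μ σ l h1
  · refine ⟨⟨by simpa [swap, Ok] using h2, by simpa [swap, Ok, next] using h1⟩, by simp [swap],
      by simp [swap], ?_⟩
    rintro μ σ l rfl
    exact step_stayOne_move b μ σ l h1
  · by_cases hs : v⁻¹ • i ∈ b.support
    · refine ⟨?_, by simp [swap, hs], by simp [swap, hs], ?_⟩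
      · simp [swap, hs, PairOk, Ok, next]
      · rintro μ σ l rfl
        simp only [swap, if_pos hs]
        exact State.flipSign_comm (step_move_move b μ σ l hs)
    · have hn := (mem_support_of_canMove b h1 h2).resolve_left hs
      refine ⟨?_, by simp [swap, hs], by simp [swap, hs], ?_⟩
      · simp [swap, hs, hn, PairOk, Ok]
      · rintro μ σ l rfl
        simp only [swap, if_neg hs]
        exact State.flipSign_comm (step_move_move_of_neg b μ σ l hn)

end Swap

/-! ### Sequences of choices along a path with a segment `α, -α` -/

section Lists

/-- The sequences of possible choices for the steps in `s`, beginning at `w`. -/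
abbrev Choices (b : P.Base) (w : P.weylGroup) (s : List (ι × ℤ)) : Type _ :=
  {a : List ((ι × ℤ) × Choice) // a.map Prod.fst = s ∧ Valid b w a}

/-- The sequence consisting of the steps in `p.1.1`, two steps along `α, -α` with the choices `p.2`,
and the steps in `p.1.2`. -/
def join (P : RootPairing ι ℝ M N) (i : ι) (l : ℤ)
    (p : (List ((ι × ℤ) × Choice) × List ((ι × ℤ) × Choice)) × (Choice × Choice)) :
    List ((ι × ℤ) × Choice) :=
  p.1.1 ++ ((i, l), p.2.1) :: ((negIdx P i, -l), p.2.2) :: p.1.2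

lemma valid_join (b : P.Base) (w : P.weylGroup) (i : ι) (l : ℤ)
    (p : (List ((ι × ℤ) × Choice) × List ((ι × ℤ) × Choice)) × (Choice × Choice)) :
    Valid b w (join P i l p) ↔ Valid b w p.1.1 ∧ PairOk b (endpoint w p.1.1) i p.2 ∧
      Valid b (p.2.2.next (p.2.1.next (endpoint w p.1.1) i) (negIdx P i)) p.1.2 := by
  simp only [join, valid_append, Valid, PairOk, and_assoc]

/-- The sequences of choices along a path with a segment `α, -α`, decomposed into the choices
before, within, and after this segment. -/
abbrev SplitChoices (b : P.Base) (w : P.weylGroup) (s₁ s₂ : List (ι × ℤ)) (i : ι) (l : ℤ) :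
    Type _ :=
  {p : (List ((ι × ℤ) × Choice) × List ((ι × ℤ) × Choice)) × (Choice × Choice) //
    p.1.1.map Prod.fst = s₁ ∧ p.1.2.map Prod.fst = s₂ ∧ Valid b w (join P i l p)}

variable (b : P.Base) (w : P.weylGroup) (s₁ s₂ : List (ι × ℤ)) (i : ι) (l : ℤ)

/-- Joining the parts of a decomposed sequence of choices is a bijection. -/
def splitEquiv : SplitChoices b w s₁ s₂ i l ≃
    Choices b w (s₁ ++ (i, l) :: (negIdx P i, -l) :: s₂) :=
  Equiv.ofBijective
    (fun p => ⟨join P i l p.1, by simp [join, p.2.1, p.2.2.1], p.2.2.2⟩) <| by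
    constructor
    · rintro ⟨⟨⟨a, a'⟩, c, c'⟩, h1, h2, h3⟩ ⟨⟨⟨e, e'⟩, d, d'⟩, h1', h2', h3'⟩ h
      replace h : a ++ ((i, l), c) :: (_, c') :: a' = e ++ ((i, l), d) :: (_, d') :: e' :=
        congrArg Subtype.val h
      replace h1 : a.map Prod.fst = s₁ := h1
      replace h1' : e.map Prod.fst = s₁ := h1'
      obtain ⟨rfl, hcons⟩ := List.append_inj h (by
        rw [← List.length_map (f := Prod.fst), h1, ← h1', List.length_map])
      simp only [List.cons.injEq, Prod.mk.injEq, true_and] at hcons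
      obtain ⟨rfl, rfl, rfl⟩ := hcons
      rfl
    · rintro ⟨a, h1, h2⟩
      obtain ⟨a₁, a', rfl, ha₁, ha'⟩ := List.map_eq_append_iff.1 h1
      obtain ⟨⟨x, c⟩, a'', rfl, rfl, ha''⟩ := List.map_eq_cons_iff.1 ha'
      obtain ⟨⟨y, c'⟩, a₂, rfl, rfl, ha₂⟩ := List.map_eq_cons_iff.1 ha''
      exact ⟨⟨((a₁, a₂), (c, c')), ha₁, ha₂, h2⟩, rfl⟩

/-- The decomposed sequences of choices which stay, with decorations `0`, within the segment
`α, -α`, correspond to the sequences of choices along the path without this segment. -/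
def deletionEquiv : {p : SplitChoices b w s₁ s₂ i l // p.1.2 = (stay, stay)} ≃
    Choices b w (s₁ ++ s₂) :=
  Equiv.ofBijective
    (fun p => ⟨p.1.1.1.1 ++ p.1.1.1.2, by simp [p.1.2.1, p.1.2.2.1], by
      have h := p.1.2.2.2
      rw [valid_join, p.2] at h
      exact (valid_append _ _ _ _).2 ⟨h.1, h.2.2⟩⟩) <| by
    constructor
    · rintro ⟨⟨⟨⟨a, a'⟩, c⟩, h1, h2, h3⟩, hc⟩ ⟨⟨⟨⟨e, e'⟩, d⟩, h1', h2', h3'⟩, hd⟩ h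
      replace h : a ++ a' = e ++ e' := congrArg Subtype.val h
      replace h1 : a.map Prod.fst = s₁ := h1
      replace h1' : e.map Prod.fst = s₁ := h1'
      replace hc : c = (stay, stay) := hc
      replace hd : d = (stay, stay) := hd
      subst hc hd
      obtain ⟨rfl, rfl⟩ := List.append_inj h (by
        rw [← List.length_map (f := Prod.fst), h1, ← h1', List.length_map])
      rfl
    · rintro ⟨a, h1, h2⟩
      obtain ⟨a₁, a₂, rfl, ha₁, ha₂⟩ := List.map_eq_append_iff.1 h1
      rw [valid_append] at h2
      exact ⟨⟨⟨((a₁, a₂), (stay, stay)), ha₁, ha₂,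
        (valid_join _ _ _ _ _).2 ⟨h2.1, ⟨trivial, trivial⟩, h2.2⟩⟩, rfl⟩, rfl⟩

lemma run_join (μ : M) (σ : State P)
    (p : (List ((ι × ℤ) × Choice) × List ((ι × ℤ) × Choice)) × (Choice × Choice)) :
    σ.run b μ (join P i l p) =
      ((σ.run b μ p.1.1).twoSteps b μ i l p.2).run b μ p.1.2 := by
  rw [join, State.run_append]
  rfl

lemma run_deletionEquiv (μ : M) (σ : State P)
    (p : {p : SplitChoices b w s₁ s₂ i l // p.1.2 = (stay, stay)}) :
    σ.run b μ (deletionEquiv b w s₁ s₂ i l p).1 =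
      σ.run b μ (splitEquiv b w s₁ s₂ i l p.1).1 := by
  change σ.run b μ (p.1.1.1.1 ++ p.1.1.1.2) = σ.run b μ (join P i l p.1.1)
  rw [run_join, p.2, State.run_append]
  rfl

variable [Finite ι] [P.IsCrystallographic] [P.IsReduced]

/-- The involution `swap`, applied within the segment `α, -α`. -/
def swapSplit (p : {p : SplitChoices b w s₁ s₂ i l // ¬ p.1.2 = (stay, stay)}) :
    {p : SplitChoices b w s₁ s₂ i l // ¬ p.1.2 = (stay, stay)} :=
  ⟨⟨(p.1.1.1, swap b (endpoint w p.1.1.1.1) i p.1.1.2), p.1.2.1, p.1.2.2.1, by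
    have h := p.1.2.2.2
    rw [valid_join] at h ⊢
    obtain ⟨hok, -, -, hrun⟩ := swap_spec b _ i p.1.1.2 p.2 h.2.1
    refine ⟨h.1, hok, ?_⟩
    -- equality of the statistics after the two steps includes that of the positions
    have := congrArg State.pos
      (hrun 0 { pos := endpoint w p.1.1.1.1, sign := 0, q := 0, qCo := 0, wt := 0, d := 0 } 0 rfl)
    simp only [State.twoSteps, State.flipSign, State.pos_step] at this
    rw [this]
    exact h.2.2⟩, by
    have h := p.1.2.2.2
    rw [valid_join] at h
    exact (swap_spec b _ i p.1.1.2 p.2 h.2.1).2.1⟩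

lemma swapSplit_involutive : Function.Involutive (swapSplit b w s₁ s₂ i l) := by
  intro p
  have h := p.1.2.2.2
  rw [valid_join] at h
  have := (swap_spec b _ i p.1.1.2 p.2 h.2.1).2.2.1
  exact Subtype.ext (Subtype.ext (Prod.ext rfl this))

lemma run_swapSplit (μ : M) (σ : State P) (hσ : σ.pos = w)
    (p : {p : SplitChoices b w s₁ s₂ i l // ¬ p.1.2 = (stay, stay)}) :
    σ.run b μ (splitEquiv b w s₁ s₂ i l (swapSplit b w s₁ s₂ i l p).1).1 =
      (σ.run b μ (splitEquiv b w s₁ s₂ i l p.1).1).flipSign := by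
  have h := p.1.2.2.2
  rw [valid_join] at h
  change σ.run b μ (join P i l (p.1.1.1, swap b (endpoint w p.1.1.1.1) i p.1.1.2)) =
    (σ.run b μ (join P i l p.1.1)).flipSign
  rw [run_join, run_join, ← State.run_flipSign,
    (swap_spec b _ i p.1.1.2 p.2 h.2.1).2.2.2 μ _ l (by rw [State.pos_run, hσ])]

end Lists

/-! ### The sequence of choices of a decorated walk -/

section OfFn

lemma foldl_ofFn {α β : Type*} (f : β → α → β) {m : ℕ} (a : Fin m → α) (x : Fin (m + 1) → β)
    (h : ∀ t : Fin m, x t.succ = f (x t.castSucc) (a t)) :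
    (List.ofFn a).foldl f (x 0) = x (Fin.last m) := by
  induction m with
  | zero => rfl
  | succ m ih =>
    rw [List.ofFn_succ, List.foldl_cons]
    have := h 0
    rw [Fin.castSucc_zero] at this
    rw [← this]
    exact ih (fun t => a t.succ) (fun t => x t.succ) fun t => h t.succ

lemma valid_ofFn (b : P.Base) {m : ℕ} (a : Fin m → (ι × ℤ) × Choice)
    (x : Fin (m + 1) → P.weylGroup)
    (h : ∀ t : Fin m, x t.succ = (a t).2.next (x t.castSucc) (a t).1.1) :
    Valid b (x 0) (List.ofFn a) ↔ ∀ t : Fin m, (a t).2.Ok b (x t.castSucc) (a t).1.1 := by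
  induction m with
  | zero => simp [Valid]
  | succ m ih =>
    have := h 0
    rw [Fin.castSucc_zero] at this
    rw [List.ofFn_succ, Valid, ← this, Fin.forall_fin_succ]
    exact and_congr Iff.rfl (ih (fun t => a t.succ) (fun t => x t.succ) fun t => h t.succ)

@[to_additive]
lemma prod_filter_castSucc_lt_succ {A : Type*} [CommMonoid A] {m : ℕ} (f : Fin m → A)
    (t : Fin m) :
    ∏ u : Fin m with u.castSucc < t.succ, f u =
      (∏ u : Fin m with u.castSucc < t.castSucc, f u) * f t := by
  have : ({u | u.castSucc < t.succ} : Finset (Fin m)) =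
      insert t ({u | u.castSucc < t.castSucc} : Finset (Fin m)) := by
    ext u
    simp [Fin.castSucc_lt_succ_iff, le_iff_eq_or_lt]
  rw [this, Finset.prod_insert (by simp), mul_comm]

@[to_additive]
lemma prod_filter_castSucc_lt_succ_and {A : Type*} [CommMonoid A] {m : ℕ} (p : Fin m → Prop)
    [DecidablePred p] (f : Fin m → A) (t : Fin m) :
    ∏ u : Fin m with u.castSucc < t.succ ∧ p u, f u =
      (∏ u : Fin m with u.castSucc < t.castSucc ∧ p u, f u) * if p t then f t else 1 := by
  rw [← Finset.filter_filter, ← Finset.filter_filter, Finset.prod_filter, Finset.prod_filter p,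
    prod_filter_castSucc_lt_succ]

@[to_additive]
lemma prod_filter_castSucc_lt_last_and {A : Type*} [CommMonoid A] {m : ℕ} (p : Fin m → Prop)
    [DecidablePred p] (f : Fin m → A) :
    ∏ u : Fin m with u.castSucc < Fin.last m ∧ p u, f u = ∏ u : Fin m with p u, f u :=
  Finset.prod_congr (by ext u; simp [Fin.castSucc_lt_last]) fun _ _ => rfl

end OfFn

namespace Walk

variable {b : P.Base} {m : ℕ} {γ : Fin m → ι} {w : P.weylGroup}

lemma ext_pt {W W' : Walk b γ w} (h : W.pt = W'.pt) : W = W' := by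
  cases W; cases W'; cases h; rfl

lemma rhat_succ (W : Walk b γ w) (l : Fin m → ℤ) (t : Fin m) [Decidable (t ∈ W.T)] :
    W.rhat l t.succ =
      if t ∈ W.T then W.rhat l t.castSucc ∘ affineReflection P (γ t) (l t)
      else W.rhat l t.castSucc := by
  rw [rhat, Fin.induction_succ]
  congr

/-- The linear part of the affine map `r̂_t` is `w_t⁻¹`. -/
lemma rhat_sub (W : Walk b γ w) (l : Fin m → ℤ) (t : Fin (m + 1)) (x y : M) :
    W.rhat l t (x - y) = W.rhat l t x - (W.pt t)⁻¹ • y := by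
  classical
  induction t using Fin.induction generalizing x y with
  | zero => simp [rhat, W.start, smul_sub]
  | succ t ih =>
    rw [rhat_succ]
    split_ifs with h
    · have h' : W.pt t.succ = weylGroup.ofIdx P (γ t) * W.pt t.castSucc := h
      have haff : affineReflection P (γ t) (l t) (x - y) =
          affineReflection P (γ t) (l t) x - weylGroup.ofIdx P (γ t) • y := by
        rw [ofIdx_smul_weight]
        simp only [affineReflection, map_sub, LinearMap.sub_apply]
        module
      rw [Function.comp_apply, Function.comp_apply, haff, ih, h', mul_inv_rev, ofIdx_inv,
        mul_smul]
    · rw [ih, (W.step t).resolve_right h]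

lemma rhat_succ_of_mem (W : Walk b γ w) (l : Fin m → ℤ) (μ : M) {t : Fin m} (h : t ∈ W.T) :
    W.rhat l t.succ μ = W.rhat l t.castSucc μ -
      (P.toLinearMap μ (P.coroot (γ t)) - l t : ℝ) • P.root ((W.pt t.castSucc)⁻¹ • γ t) := by
  classical
  rw [rhat_succ, if_pos h, Function.comp_apply, affineReflection, rhat_sub, smul_comm, root_smul]

lemma rhat_succ_of_notMem (W : Walk b γ w) (l : Fin m → ℤ) (μ : M) {t : Fin m} (h : t ∉ W.T) :
    W.rhat l t.succ μ = W.rhat l t.castSucc μ := by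
  classical
  rw [rhat_succ, if_neg h]

lemma notMem_T_of_eq (W : Walk b γ w) {t : Fin m} (h : W.pt t.succ = W.pt t.castSucc) :
    t ∉ W.T := fun h' => ofIdx_ne_one (P := P) (γ t) (by
  change W.pt t.succ = _ at h'
  rw [h, eq_comm, mul_eq_right] at h'
  exact h')

lemma notMem_Tminus_of_eq (W : Walk b γ w) {t : Fin m} (h : W.pt t.succ = W.pt t.castSucc) :
    t ∉ W.Tminus := fun h' => by
  have := length_lt_of_bruhatLT b h'
  rw [h] at this
  exact lt_irrefl _ this

lemma notMem_Tplus_of_eq (W : Walk b γ w) {t : Fin m} (h : W.pt t.succ = W.pt t.castSucc) :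
    t ∉ W.Tplus := fun h' => by
  have := length_lt_of_bruhatLT b h'
  rw [h] at this
  exact lt_irrefl _ this

lemma notMem_S_of_mem_T (W : Walk b γ w) {t : Fin m} (h : t ∈ W.T) : t ∉ W.S :=
  fun h' => W.notMem_T_of_eq h'.1 h

lemma mem_Tminus_iff (W : Walk b γ w) {t : Fin m} (h : t ∈ W.T) :
    t ∈ W.Tminus ↔
      length b (weylGroup.ofIdx P (γ t) * W.pt t.castSucc) < length b (W.pt t.castSucc) := by
  rw [← ofIdx_mul_bruhatLT_iff, ← show W.pt t.succ = _ from h]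
  rfl

lemma mem_Tplus_iff (W : Walk b γ w) {t : Fin m} (h : t ∈ W.T) :
    t ∈ W.Tplus ↔
      length b (W.pt t.castSucc) < length b (weylGroup.ofIdx P (γ t) * W.pt t.castSucc) := by
  rw [← bruhatLT_ofIdx_mul_iff, ← show W.pt t.succ = _ from h]
  rfl

end Walk

namespace DecoratedWalk

variable {b : P.Base} {m : ℕ} {γ : Fin m → ι} {w : P.weylGroup}

open scoped Classical in
/-- The choice made by a decorated walk in the step `t`. Decoration `0` is not distinguished from
the absence of a decoration, since `S` is determined by the positions. -/
def choice (D : DecoratedWalk b γ w) (t : Fin m) : Choice :=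
  if t ∈ D.walk.T then move else if D.val t = 0 then stay else stayOne

lemma val_eq_zero_of_notMem (D : DecoratedWalk b γ w) {t : Fin m} (h : t ∉ D.walk.S) :
    D.val t = 0 := dif_neg h

lemma val_le_one (D : DecoratedWalk b γ w) (t : Fin m) : D.val t ≤ 1 := by
  unfold val
  split_ifs <;> omega

lemma choice_cases (D : DecoratedWalk b γ w) (t : Fin m) :
    (D.choice t = move ∧ t ∈ D.walk.T ∧
      D.walk.pt t.succ = weylGroup.ofIdx P (γ t) * D.walk.pt t.castSucc) ∨
    (D.choice t = stay ∧ D.walk.pt t.succ = D.walk.pt t.castSucc ∧ D.val t = 0) ∨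
    (D.choice t = stayOne ∧ D.walk.pt t.succ = D.walk.pt t.castSucc ∧ D.val t = 1 ∧
      t ∈ D.walk.S) := by
  by_cases h : t ∈ D.walk.T
  · exact .inl ⟨if_pos h, h, h⟩
  · have h' := (D.walk.step t).resolve_right h
    by_cases h0 : D.val t = 0
    · exact .inr (.inl ⟨by rw [choice, if_neg h, if_pos h0], h', h0⟩)
    · refine .inr (.inr ⟨by rw [choice, if_neg h, if_neg h0], h', ?_, ?_⟩)
      · have := D.val_le_one t
        omega
      · by_contra hS
        exact h0 (D.val_eq_zero_of_notMem hS)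

lemma pt_succ (D : DecoratedWalk b γ w) (t : Fin m) :
    D.walk.pt t.succ = (D.choice t).next (D.walk.pt t.castSucc) (γ t) := by
  rcases D.choice_cases t with ⟨h, h'⟩ | ⟨h, h'⟩ | ⟨h, h'⟩ <;> rw [h]
  exacts [h'.2, h'.1, h'.1]

lemma choice_ok (D : DecoratedWalk b γ w) (t : Fin m) :
    (D.choice t).Ok b (D.walk.pt t.castSucc) (γ t) := by
  rcases D.choice_cases t with ⟨h, h'⟩ | ⟨h, h'⟩ | ⟨h, h'⟩ <;> rw [h]
  · have := D.walk.edge t h'.2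
    rwa [h'.2] at this
  · trivial
  · have := h'.2.2.2
    rwa [h'.1] at this

lemma ext_choice {D D' : DecoratedWalk b γ w} (h : D.choice = D'.choice) : D = D' := by
  have hpt : D.walk.pt = D'.walk.pt := by
    funext t
    induction t using Fin.induction with
    | zero => rw [D.walk.start, D'.walk.start]
    | succ t ih => rw [D.pt_succ, D'.pt_succ, ih, h]
  obtain ⟨W, d⟩ := D
  obtain ⟨W', d'⟩ := D'
  obtain rfl : W = W' := Walk.ext_pt hpt
  congr 1
  funext ⟨t, ht⟩
  have hval : (DecoratedWalk.mk W d).val t = (DecoratedWalk.mk W d').val t := by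
    have h1 := (DecoratedWalk.mk W d).choice_cases t
    have h2 := (DecoratedWalk.mk W d').choice_cases t
    have hT := W.notMem_T_of_eq ht.1
    rw [← h] at h2
    rcases h1 with h1 | h1 | h1 <;> rcases h2 with h2 | h2 | h2 <;> simp_all
  simp only [val, dif_pos ht] at hval
  exact Fin.ext hval

lemma exists_choice_eq (c : Fin m → Choice) (x : Fin (m + 1) → P.weylGroup) (h0 : x 0 = w)
    (hx : ∀ t : Fin m, x t.succ = (c t).next (x t.castSucc) (γ t))
    (hc : ∀ t : Fin m, (c t).Ok b (x t.castSucc) (γ t)) :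
    ∃ D : DecoratedWalk b γ w, D.choice = c := by
  classical
  have hmove (t : Fin m) (h : x t.succ = weylGroup.ofIdx P (γ t) * x t.castSucc) :
      c t = move := by
    rw [hx t] at h
    cases hct : c t with
    | move => rfl
    | _ =>
      rw [hct, next, eq_comm, mul_eq_right] at h
      · exact absurd h (ofIdx_ne_one _)
      · simp
  let W : Walk b γ w :=
    { pt := x
      start := h0
      step := fun t => by rw [hx t]; cases c t <;> simp [next]
      edge := fun t h => by
        have := hc t
        rw [hmove t h] at this
        rw [h]
        exact this }
  refine ⟨⟨W, fun t => if c t = stayOne then 1 else 0⟩, funext fun t => ?_⟩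
  have hok := hc t
  have hxt := hx t
  cases hct : c t with
  | move =>
    rw [hct] at hxt
    exact if_pos hxt
  | stay =>
    have hT : t ∉ W.T := fun h => by simpa [hct] using hmove t h
    rw [choice, if_neg hT, if_pos]
    by_cases hS : t ∈ W.S
    · simp [val, hS, hct]
    · simp [val, hS]
  | stayOne =>
    have hT : t ∉ W.T := fun h => by simpa [hct] using hmove t h
    rw [hct] at hok hxt
    have hS : t ∈ W.S := ⟨hxt, by
      change negIdx P ((x t.succ)⁻¹ • γ t) ∈ _
      rw [hxt]
      exact hok⟩
    rw [choice, if_neg hT, if_neg]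
    simp [val, hS, hct]

/-- The sequence of steps of a decorated walk. -/
def steps (l : Fin m → ℤ) (D : DecoratedWalk b γ w) : List ((ι × ℤ) × Choice) :=
  List.ofFn fun t => ((γ t, l t), D.choice t)

lemma steps_valid (l : Fin m → ℤ) (D : DecoratedWalk b γ w) : Valid b w (D.steps l) := by
  have h := (valid_ofFn b (fun t => ((γ t, l t), D.choice t)) D.walk.pt D.pt_succ).2 D.choice_ok
  rwa [D.walk.start] at h

variable (b γ w) in
/-- A decorated walk is determined by its sequence of choices, which is an arbitrary sequence of
possible choices. -/
def stepsEquiv (l : Fin m → ℤ) :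
    DecoratedWalk b γ w ≃ Choices b w (List.ofFn fun t => (γ t, l t)) :=
  Equiv.ofBijective (fun D => ⟨D.steps l, by simp [steps, List.map_ofFn, Function.comp_def],
    D.steps_valid l⟩) <| by
    constructor
    · intro D D' h
      refine ext_choice (funext fun t => ?_)
      have := congrFun (List.ofFn_injective (congrArg Subtype.val h)) t
      exact congrArg Prod.snd this
    · rintro ⟨a, h1, h2⟩
      obtain ⟨c, rfl⟩ : ∃ c : Fin m → Choice, a = List.ofFn fun t => ((γ t, l t), c t) := by
        have hlen : a.length = m := by simpa using congrArg List.length h1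
        subst hlen
        refine ⟨fun t => (a.get t).2, ?_⟩
        conv_lhs => rw [← List.ofFn_get a]
        congr 1
        funext t
        refine Prod.ext ?_ rfl
        have : (a.map Prod.fst)[(t : ℕ)]'(by simp) = (γ t, l t) := by simp [h1]
        simpa using this
      let x : Fin (m + 1) → P.weylGroup :=
        Fin.induction (motive := fun _ => P.weylGroup) w fun t v => (c t).next v (γ t)
      have hx (t : Fin m) : x t.succ = (c t).next (x t.castSucc) (γ t) := by
        simp only [x, Fin.induction_succ]
      obtain ⟨D, hD⟩ := exists_choice_eq (w := w) c x rfl hx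
        ((valid_ofFn b (fun t => ((γ t, l t), c t)) x hx).1 h2)
      exact ⟨D, Subtype.ext (by simp only [steps, hD])⟩

end DecoratedWalk

/-! ### The statistics of a decorated walk -/

/-- The statistics before the first step. -/
def State.init (w : P.weylGroup) (μ : M) : State P where
  pos := w
  sign := 1
  q := 0
  qCo := 0
  wt := w⁻¹ • μ
  d := 0

namespace DecoratedWalk

variable {b : P.Base} {m : ℕ} {γ : Fin m → ι} {w : P.weylGroup}

open scoped Classical in
/-- The statistics of the first `t` steps of a decorated walk. -/
def stateAt (D : DecoratedWalk b γ w) (l : Fin m → ℤ) (μ : M) (t : Fin (m + 1)) : State P where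
  pos := D.walk.pt t
  sign :=
    (∏ u : Fin m with u.castSucc < t ∧ (¬ b.IsPos (γ u) ∧ u ∈ D.walk.Tminus), (-1)) *
    (∏ u : Fin m with u.castSucc < t ∧ (b.IsPos (γ u) ∧ u ∈ D.walk.Tplus), (-1)) *
    ∏ u : Fin m with u.castSucc < t ∧ u ∈ D.walk.S, (-1) ^ D.val u
  q := D.qwtAt t
  qCo := D.qwtCoAt t
  wt := D.walk.rhat l t μ
  d :=
    (∑ u : Fin m with u.castSucc < t,
      P.toLinearMap (D.walk.wtStep l μ u) (D.qwtCoAt u.succ)) -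
    (∑ u : Fin m with u.castSucc < t ∧ u ∈ D.walk.Tminus, (sgn b (γ u) : ℝ) * lPrime γ P l μ u) -
    ∑ u : Fin m with u.castSucc < t ∧ u ∈ D.walk.S, (D.val u : ℝ) * lPrime γ P l μ u

open scoped Classical in
lemma qwtAt_succ (D : DecoratedWalk b γ w) (t : Fin m) :
    D.qwtAt t.succ = D.qwtAt t.castSucc +
      ((if t ∈ D.walk.Tminus then P.root (absIdx b ((D.walk.pt t.succ)⁻¹ • γ t)) else 0) +
        if t ∈ D.walk.S then -(D.val t • P.root ((D.walk.pt t.succ)⁻¹ • γ t)) else 0) := by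
  rw [qwtAt, sum_filter_castSucc_lt_succ_and, sum_filter_castSucc_lt_succ_and, qwtAt]
  abel

open scoped Classical in
lemma qwtCoAt_succ (D : DecoratedWalk b γ w) (t : Fin m) :
    D.qwtCoAt t.succ = D.qwtCoAt t.castSucc +
      ((if t ∈ D.walk.Tminus then P.coroot (absIdx b ((D.walk.pt t.succ)⁻¹ • γ t)) else 0) +
        if t ∈ D.walk.S then -(D.val t • P.coroot ((D.walk.pt t.succ)⁻¹ • γ t)) else 0) := by
  rw [qwtCoAt, sum_filter_castSucc_lt_succ_and, sum_filter_castSucc_lt_succ_and, qwtCoAt]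
  abel

lemma stateAt_succ (D : DecoratedWalk b γ w) (l : Fin m → ℤ) (μ : M) (t : Fin m) :
    D.stateAt l μ t.succ = (D.stateAt l μ t.castSucc).step b μ ((γ t, l t), D.choice t) := by
  classical
  have hq := D.qwtAt_succ t
  have hqCo := D.qwtCoAt_succ t
  rcases D.choice_cases t with ⟨h, hT, hpt⟩ | ⟨h, hpt, hval⟩ | ⟨h, hpt, hval, hS⟩
  · have hS := D.walk.notMem_S_of_mem_T hT
    have hm := D.walk.mem_Tminus_iff hT
    have hp := D.walk.mem_Tplus_iff hT
    have hr := D.walk.rhat_succ_of_mem l μ hT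
    rw [if_neg hS, add_zero, hpt, ofIdx_mul_inv_smul, absIdx_negIdx] at hq hqCo
    have hwt : D.walk.wtStep l μ t = -((P.toLinearMap μ (P.coroot (γ t)) - l t : ℝ) •
        P.root ((D.walk.pt t.castSucc)⁻¹ • γ t)) := by
      rw [Walk.wtStep, hr, sub_sub_cancel_left]
    rw [h]
    simp only [stateAt, State.step, prod_filter_castSucc_lt_succ_and,
      sum_filter_castSucc_lt_succ_and, sum_filter_castSucc_lt_succ, hwt, hr, if_neg hS, lPrime,
      State.mk.injEq]
    have hq' : D.qwtAt t.succ = D.qwtAt t.castSucc + descent b (D.walk.pt t.castSucc) (γ t) •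
        P.root (absIdx b ((D.walk.pt t.castSucc)⁻¹ • γ t)) := by
      rw [hq, descent, hm]; split_ifs <;> simp
    have hqCo' : D.qwtCoAt t.succ = D.qwtCoAt t.castSucc +
        descent b (D.walk.pt t.castSucc) (γ t) •
          P.coroot (absIdx b ((D.walk.pt t.castSucc)⁻¹ • γ t)) := by
      rw [hqCo, descent, hm]; split_ifs <;> simp
    refine ⟨hpt, ?_, hq', hqCo', trivial, ?_⟩
    · simp only [moveSign, hm, hp]; ring
    · simp only [hqCo', descent, hm]; split_ifs <;> (push_cast; ring)
  · have hT := D.walk.notMem_T_of_eq hpt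
    have hm := D.walk.notMem_Tminus_of_eq hpt
    have hp := D.walk.notMem_Tplus_of_eq hpt
    have hr := D.walk.rhat_succ_of_notMem l μ hT
    have hwt : D.walk.wtStep l μ t = 0 := by rw [Walk.wtStep, hr, sub_self]
    rw [if_neg hm, hval, zero_smul, neg_zero, ite_self, add_zero, add_zero] at hq hqCo
    rw [h]
    simp only [stateAt, State.step, prod_filter_castSucc_lt_succ_and,
      sum_filter_castSucc_lt_succ_and, sum_filter_castSucc_lt_succ, hwt, hr, hm, hp,
      hq, hqCo, hval, hpt]
    simp
  · have hT := D.walk.notMem_T_of_eq hpt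
    have hm := D.walk.notMem_Tminus_of_eq hpt
    have hp := D.walk.notMem_Tplus_of_eq hpt
    have hr := D.walk.rhat_succ_of_notMem l μ hT
    have hwt : D.walk.wtStep l μ t = 0 := by rw [Walk.wtStep, hr, sub_self]
    rw [if_neg hm, hval, if_pos hS, one_smul, zero_add, ← sub_eq_add_neg, hpt] at hq hqCo
    rw [h]
    simp only [stateAt, State.step, prod_filter_castSucc_lt_succ_and,
      sum_filter_castSucc_lt_succ_and, sum_filter_castSucc_lt_succ, hwt, hr, hm, hp,
      hq, hqCo, hval, hpt, if_pos hS, lPrime, State.mk.injEq]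
    simp
    ring

lemma stateAt_zero (D : DecoratedWalk b γ w) (l : Fin m → ℤ) (μ : M) :
    D.stateAt l μ 0 = State.init w μ := by
  simp [stateAt, State.init, qwtAt, qwtCoAt, Walk.rhat, D.walk.start]

lemma run_steps (D : DecoratedWalk b γ w) (l : Fin m → ℤ) (μ : M) :
    (State.init w μ).run b μ (D.steps l) = D.stateAt l μ (Fin.last m) := by
  rw [← D.stateAt_zero l μ]
  exact foldl_ofFn _ _ _ (D.stateAt_succ l μ)

lemma sign_eq (D : DecoratedWalk b γ w) (l : Fin m → ℤ) (μ : M) :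
    D.sign = ((State.init w μ).run b μ (D.steps l)).sign := by
  rw [run_steps]
  rw [sign, stateAt]
  simp only [prod_filter_castSucc_lt_last_and]

lemma deg'_eq (D : DecoratedWalk b γ w) (l : Fin m → ℤ) (μ : M) :
    D.deg' l μ = ((State.init w μ).run b μ (D.steps l)).d := by
  rw [run_steps]
  simp only [stateAt, deg', sum_filter_castSucc_lt_last_and, Fin.castSucc_lt_last,
    Finset.filter_true]

end DecoratedWalk

/-- Two decorated walks have the same statistics if they lead to the same final state, up to the
sign. -/
lemma sameStatistics_of_run [TopologicalSpace M] {b : P.Base} {μ : M} {Γ Ξ : AlcovePath b μ}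
    {w : P.weylGroup} {D : QW b Γ w} {E : QW b Ξ w} {ε : ℤ}
    (h : (State.init w μ).run b μ (E.steps Ξ.l) =
      { (State.init w μ).run b μ (D.steps Γ.l) with sign := ε }) :
    SameStatistics D E := by
  have hd : E.deg' Ξ.l μ = D.deg' Γ.l μ := by rw [E.deg'_eq, D.deg'_eq, h]
  rw [E.run_steps, D.run_steps] at h
  have hq : E.qwt = D.qwt := congrArg State.q h
  have hqCo : E.qwtCo = D.qwtCo := congrArg State.qCo h
  exact ⟨congrArg State.pos h, hq, hqCo, congrArg State.wt h, by
    rw [DecoratedWalk.deg, DecoratedWalk.deg, hq, hqCo, hd]⟩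

end QuantumWalk

end

open QuantumWalk in
theorem theorem3p11 {ι M N : Type*} [Finite ι]
    [AddCommGroup M] [Module ℝ M] [AddCommGroup N] [Module ℝ N]
    [TopologicalSpace M] [IsTopologicalAddGroup M] [ContinuousSMul ℝ M] [T2Space M]
    (P : RootPairing ι ℝ M N) [P.IsRootSystem] [P.IsCrystallographic] [P.IsReduced]
    [P.IsIrreducible] (b : P.Base) (hsl : b.cartanMatrix.IsSimplyLaced)
    (μ : M) (hμ : μ ∈ QuantumWalk.weightLattice b) (w : P.weylGroup)
    (Γ Ξ : QuantumWalk.AlcovePath b μ) (hD : QuantumWalk.IsDeletion b Γ Ξ) :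
    ∃ X : Set (QuantumWalk.QW b Γ w),
      (∃ D : X ≃ QuantumWalk.QW b Ξ w, ∀ x : X,
        (D x).sign = x.1.sign ∧ QuantumWalk.SameStatistics x.1 (D x)) ∧
      (∃ D : ↥Xᶜ → ↥Xᶜ, Function.Involutive D ∧ ∀ x : ↥Xᶜ,
        (D x).1.sign = - x.1.sign ∧ QuantumWalk.SameStatistics x.1 (D x).1) := by
  obtain ⟨s₁, s₂, i, l, hΓ, hΞ⟩ := hD.exists_levels
  let eΓ : QW b Γ w ≃ SplitChoices b w s₁ s₂ i l :=
    ((DecoratedWalk.stepsEquiv b Γ.γ w Γ.l).trans (Equiv.cast (by rw [hΓ]))).trans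
      (splitEquiv b w s₁ s₂ i l).symm
  let eΞ : QW b Ξ w ≃ Choices b w (s₁ ++ s₂) :=
    (DecoratedWalk.stepsEquiv b Ξ.γ w Ξ.l).trans (Equiv.cast (by rw [hΞ]))
  have hcast {s t : List (ι × ℤ)} (h : s = t) (h' : Choices b w s = Choices b w t)
      (a : Choices b w s) : (Equiv.cast h' a).1 = a.1 := by
    subst h; rfl
  have hstepsΓ (D : QW b Γ w) : (splitEquiv b w s₁ s₂ i l (eΓ D)).1 = D.steps Γ.l := by
    simp only [eΓ, Equiv.trans_apply, Equiv.apply_symm_apply]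
    exact hcast hΓ _ _
  have hstepsΞ (D : QW b Ξ w) : (eΞ D).1 = D.steps Ξ.l := hcast hΞ _ _
  let X : Set (QW b Γ w) := {D | (eΓ D).1.2 = (Choice.stay, Choice.stay)}
  let eX : X ≃ {p : SplitChoices b w s₁ s₂ i l // p.1.2 = (Choice.stay, Choice.stay)} :=
    eΓ.subtypeEquiv fun _ => Iff.rfl
  let eXc : ↥Xᶜ ≃ {p : SplitChoices b w s₁ s₂ i l // ¬ p.1.2 = (Choice.stay, Choice.stay)} :=
    eΓ.subtypeEquiv fun _ => Iff.rfl
  refine ⟨X, ⟨(eX.trans (deletionEquiv b w s₁ s₂ i l)).trans eΞ.symm, fun x => ?_⟩,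
    fun x => eXc.symm (swapSplit b w s₁ s₂ i l (eXc x)), fun x => ?_, fun x => ?_⟩
  · set E := ((eX.trans (deletionEquiv b w s₁ s₂ i l)).trans eΞ.symm) x with hE
    have hrun : (State.init w μ).run b μ (E.steps Ξ.l) =
        (State.init w μ).run b μ (x.1.steps Γ.l) := by
      rw [← hstepsΞ, ← hstepsΓ, hE]
      simp only [Equiv.trans_apply, Equiv.apply_symm_apply]
      exact run_deletionEquiv b w s₁ s₂ i l μ _ (eX x)
    exact ⟨by rw [E.sign_eq Ξ.l μ, x.1.sign_eq Γ.l μ, hrun], sameStatistics_of_run hrun⟩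
  · simp only [Equiv.apply_symm_apply, swapSplit_involutive b w s₁ s₂ i l _,
      Equiv.symm_apply_apply]
  · set E := (eXc.symm (swapSplit b w s₁ s₂ i l (eXc x))) with hE
    have hrun : (State.init w μ).run b μ (E.1.steps Γ.l) =
        ((State.init w μ).run b μ (x.1.steps Γ.l)).flipSign := by
      have hE' : eΓ E.1 = (swapSplit b w s₁ s₂ i l (eXc x)).1 :=
        congrArg Subtype.val (eXc.apply_symm_apply (swapSplit b w s₁ s₂ i l (eXc x)))
      rw [← hstepsΓ, ← hstepsΓ, hE']
      exact run_swapSplit b w s₁ s₂ i l μ _ rfl (eXc x)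
    exact ⟨by rw [E.1.sign_eq Γ.l μ, x.1.sign_eq Γ.l μ, hrun]; rfl, sameStatistics_of_run hrun⟩
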